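/- There is a universal constant $c>0$ such that the following holds. Let $d,T\ge 1$, let $\mathcal X,\mathcal Y\subset\mathbb R^d$ be nonempty compact convex sets, and let $D=\max\{\sup_{x_1,x_2\in\mathcal X}\|x_1-x_2\|_2,\ \sup_{y_1,y_2\in\mathcal Y}\|y_1-y_2\|_2\}$. Let $f:\mathcal X\times\mathcal Y\to\mathbb R$ be convex in $x$, concave in $y$ and differentiable in each variable, with partial gradients satisfying $\|\nabla_x f(x,y)\|_2\le G$ and $\|\nabla_y f(x,y)\|_2\le G$ for all $(x,y)\in\mathcal X\times\mathcal Y$ (so that $f$ is Lipschitz), and, for all $x,x'\in\mathcal X$, $y,y'\in\mathcal Y$, $$\|\nabla_x f(x,y)-\nabla_x f(x',y')\|_2+\|\nabla_y f(x,y)-\nabla_y f(x',y')\|_2\le L\|x-x'\|_2+L\|y-y'\|_2 .$$ Put $\eta=6dD(L+1)$ and $m=T$. Let $\sigma^{1}_{t,j},\sigma^{2}_{t,j},\tilde\sigma^{1}_{t,j},\tilde\sigma^{2}_{t,j}$ ($1\le t\le T$, $1\le j\le m$) be independent random vectors, each uniformly distributed over the ball $\{z\in\mathbb R^d:\|z\|_2\le(1+d^{-1})\eta\}$.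 Optimistic follow-the-perturbed-leader generates random iterates $(x_t,y_t)_{t=1}^T$ as follows. For $t=1$, with arbitrary choices of the optimizers, $$x_1=\frac1m\sum_{j=1}^m x_{1,j},\quad x_{1,j}\in\operatorname*{argmin}_{x\in\mathcal X}\langle-\sigma^1_{1,j},x\rangle,\qquad y_1=\frac1m\sum_{j=1}^m y_{1,j},\quad y_{1,j}\in\operatorname*{argmax}_{y\in\mathcal Y}\langle\sigma^2_{1,j},y\rangle .$$ For $2\le t\le T$ put $A_t=\sum_{i=1}^{t-1}\nabla_x f(x_i,y_i)$ and $B_t=\sum_{i=1}^{t-1}\nabla_y f(x_i,y_i)$. First compute $$\tilde x_{t-1}=\frac1m\sum_{j=1}^m\tilde x_{t-1,j},\quad \tilde x_{t-1,j}\in\operatorname*{argmin}_{x\in\mathcal X}\langle A_t-\tilde\sigma^1_{t,j},x\rangle,\qquad \tilde y_{t-1}=\frac1m\sum_{j=1}^m\tilde y_{t-1,j},\quad \tilde y_{t-1,j}\in\operatorname*{argmax}_{y\in\mathcal Y}\langle B_t+\tilde\sigma^2_{t,j},y\rangle,$$ and then $$x_t=\frac1m\sum_{j=1}^m x_{t,j},\quad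 x_{t,j}\in\operatorname*{argmin}_{x\in\mathcal X}\langle A_t+\nabla_x f(\tilde x_{t-1},\tilde y_{t-1})-\sigma^1_{t,j},x\rangle,$$ $$y_t=\frac1m\sum_{j=1}^m y_{t,j},\quad y_{t,j}\in\operatorname*{argmax}_{y\in\mathcal Y}\langle B_t+\nabla_y f(\tilde x_{t-1},\tilde y_{t-1})+\sigma^2_{t,j},y\rangle .$$ Then for every $\delta\in(0,1)$, with probability at least $1-\delta$, $$\sup_{x\in\mathcal X,\,y\in\mathcal Y}\left[f\Big(\frac1T\sum_{t=1}^T x_t,\,y\Big)-f\Big(x,\,\frac1T\sum_{t=1}^T y_t\Big)\right]\le c\left(\frac{GD\sqrt{\log(8/\delta)}}{T}+\frac{D^2(L+1)\big(d+\log(16T/\delta)\big)}{T}\right).$$ -/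

import Mathlib

open MeasureTheory ProbabilityTheory

namespace OFTPL

/-- The Euclidean space `ℝ^d`, with the norm `‖·‖₂`. -/
abbrev E (d : ℕ) : Type := EuclideanSpace ℝ (Fin d)

/-- The two players of the minimax game. -/
inductive Player : Type
  | xPlayer
  | yPlayer

/-- The two places in a round at which perturbations are drawn: the computation of the guess, and
the computation of the action that is played. -/
inductive Stage : Type
  | guess
  | play

/-- The uniform distribution over the ball `{z ∈ ℝ^d : ‖z‖₂ ≤ r}`: the normalized Lebesgue measure
for `r > 0`, and the point mass at the origin if the ball degenerates to `{0}`. -/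
noncomputable def uniformBall (d : ℕ) (r : ℝ) : Measure (E d) :=
  if 0 < r then ProbabilityTheory.cond volume (Metric.closedBall (0 : E d) r)
  else Measure.dirac 0

/-- `z = m⁻¹ ∑ⱼ zⱼ` where `zⱼ ∈ argmin_{u ∈ X} ⟨v - sⱼ, u⟩` for every `j`. -/
def IsPerturbedMin {d m : ℕ} (X : Set (E d)) (v : E d) (s : Fin m → E d) (z : E d) : Prop :=
  ∃ w : Fin m → E d,
    (∀ j, w j ∈ X ∧ IsMinOn (fun u : E d => inner ℝ (v - s j) u) X (w j)) ∧
      z = (m : ℝ)⁻¹ • ∑ j, w j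

/-- `z = m⁻¹ ∑ⱼ zⱼ` where `zⱼ ∈ argmax_{u ∈ Y} ⟨v + sⱼ, u⟩` for every `j`. -/
def IsPerturbedMax {d m : ℕ} (Y : Set (E d)) (v : E d) (s : Fin m → E d) (z : E d) : Prop :=
  ∃ w : Fin m → E d,
    (∀ j, w j ∈ Y ∧ IsMaxOn (fun u : E d => inner ℝ (v + s j) u) Y (w j)) ∧
      z = (m : ℝ)⁻¹ • ∑ j, w j

/-- `x, y` are iterates of the optimistic follow-the-perturbed-leader algorithm for the game with
partial gradients `gx = ∇ₓf`, `gy = ∇_y f`, run for `T` rounds with `m` samples per prediction and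
with the perturbations `σ`. Rounds are numbered from `0`. -/
structure IsRun {d m T : ℕ} (X Y : Set (E d)) (gx gy : E d → E d → E d)
    (σ : Player → Stage → Fin T → Fin m → E d) (x y : Fin T → E d) : Prop where
  /-- In the first round both players use the zero guess. -/
  first : ∀ t : Fin T, t.val = 0 →
    IsPerturbedMin X 0 (σ .xPlayer .play t) (x t) ∧
    IsPerturbedMax Y 0 (σ .yPlayer .play t) (y t)
  /-- In every later round both players first compute their predictions `x', y'` for the zero
  guess, then play with the guesses `∇ₓf(x', y')`, `∇_y f(x', y')` and fresh perturbations. -/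
  later : ∀ t : Fin T, 0 < t.val → ∃ x' y' : E d,
    IsPerturbedMin X (∑ i ∈ Finset.Iio t, gx (x i) (y i)) (σ .xPlayer .guess t) x' ∧
    IsPerturbedMax Y (∑ i ∈ Finset.Iio t, gy (x i) (y i)) (σ .yPlayer .guess t) y' ∧
    IsPerturbedMin X ((∑ i ∈ Finset.Iio t, gx (x i) (y i)) + gx x' y') (σ .xPlayer .play t) (x t) ∧
    IsPerturbedMax Y ((∑ i ∈ Finset.Iio t, gy (x i) (y i)) + gy x' y') (σ .yPlayer .play t) (y t)

end OFTPL

namespace OFTPL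

/-! Write both players as minimizers facing the joint operator F = (∇ₓf, -∇_y f). By Jensen and the
gradient inequality (`sub_le_of_convexOn_concaveOn`), T times the duality gap is at most the sum of
the two linear regrets, so it suffices to bound that sum by a quantity that grows only
logarithmically in T.

Averaging the support function of the action set over the perturbation gives a concave potential,
`meanValue`, with supergradient `meanAction`. Translated balls overlap heavily, so `meanAction` is
dD/R-Lipschitz (`norm_meanAction_sub_le`), and the concavity inequality gains a negative quadratic
term (`meanValue_le_add_inner_sub_sq`). Two uses of it per round make the potential telescope and
leave a guess error times a change of action, minus squared changes of action
(`inner_meanAction_le`). The guess error is itself controlled, through the Lipschitz operator, by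
changes of mean actions and sampling noise; the choice of η makes the negative squares absorb
everything but the noise. This is the deterministic bound `sum_inner_playPoint_sub_le`.

Two noises remain. The linear one is a martingale difference, sub-Gaussian by Hoeffding's lemma; the
squared one has exponential moments by Gaussian linearization (`lintegral_exp_sq_norm_le`).
Averaging m = T samples shrinks the squared noise of a round to order D²d/T, so its sum over T
rounds is of order D²d, plus a logarithm from the tail. Multiplying exponential moments along the
order of computations and applying Markov's inequality gives `exists_measurableSet_noise_le`.

The optimizers are arbitrary and need not be measurable. Linear functionals have almost everywhere a
unique minimizer on a compact set, so almost surely every run coincides with the one built from a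
measurable selection (`ae_eq_playPoint`). -/

/-! ### Almost everywhere unique minimizers of linear functionals. -/

/-- `s` is a measurable selection of the almost everywhere unique minimizers over `X` of linear
functionals. -/
structure IsArgminSelection {d : ℕ} (X : Set (E d)) (s : E d → E d) : Prop where
  measurable : Measurable s
  mem : ∀ v, s v ∈ X
  ae_eq : ∀ᵐ v, ∀ u ∈ X, IsMinOn (fun u => inner ℝ v u) X u → u = s v

/-- The minimal value h is Lipschitz, hence differentiable almost everywhere by Rademacher. Where it
is differentiable, every minimizer equals its gradient, so the measurable map v ↦ ∇h(v), completed
by a constant, is the selection. -/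
theorem exists_isArgminSelection {d : ℕ} {X : Set (E d)} (hX : IsCompact X) (hne : X.Nonempty) :
    ∃ s, IsArgminSelection X s := by
  classical
  have hex (v : E d) : ∃ a ∈ X, IsMinOn (fun u => inner ℝ v u) X a :=
    hX.exists_isMinOn hne (by fun_prop)
  choose a haX ha using hex
  obtain ⟨x₀, hx₀⟩ := hne
  obtain ⟨C, hC⟩ := hX.isBounded.exists_norm_le
  have hC0 : 0 ≤ C := (norm_nonneg _).trans (hC x₀ hx₀)
  set h : E d → ℝ := fun v => inner ℝ v (a v) with hh
  have hlip : LipschitzWith C.toNNReal h := by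
    refine LipschitzWith.of_le_add_mul _ fun v w => ?_
    have h1 : h v ≤ inner ℝ v (a w) := ha v (haX w)
    have h2 : (inner ℝ v (a w) : ℝ) = h w + inner ℝ (v - w) (a w) := by
      simp [hh, inner_sub_left]
    have h3 : (inner ℝ (v - w) (a w) : ℝ) ≤ ‖v - w‖ * C :=
      (real_inner_le_norm _ _).trans (by gcongr; exact hC _ (haX w))
    rw [Real.coe_toNNReal _ hC0, dist_eq_norm]
    linarith
  have key (v : E d) (hv : DifferentiableAt ℝ h v) (u : E d) (hu : u ∈ X)
      (hmin : IsMinOn (fun u => inner ℝ v u) X u) :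
      u = (InnerProductSpace.toDual ℝ (E d)).symm (fderiv ℝ h v) := by
    -- The linear function given by a minimizer u at v lies above h everywhere and touches it at v.
    have hloc : IsLocalMin (fun w => inner ℝ u w - h w) v := by
      refine Filter.Eventually.of_forall fun w => ?_
      have h1 : h w ≤ inner ℝ w u := ha w hu
      have h2 : (inner ℝ v u : ℝ) ≤ h v := hmin (haX v)
      rw [real_inner_comm] at h1 h2
      simp only
      linarith
    have hd : HasFDerivAt (fun w => inner ℝ u w - h w) (innerSL ℝ u - fderiv ℝ h v) v :=
      (innerSL ℝ u).hasFDerivAt.sub hv.hasFDerivAt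
    have h0 := hloc.hasFDerivAt_eq_zero hd
    rw [LinearIsometryEquiv.eq_symm_apply]
    rw [sub_eq_zero] at h0
    rw [← h0]
    ext w
    simp
  refine ⟨fun v => if DifferentiableAt ℝ h v then
      (InnerProductSpace.toDual ℝ (E d)).symm (fderiv ℝ h v) else x₀, ?_, ?_, ?_⟩
  · exact Measurable.ite (measurableSet_of_differentiableAt ℝ h)
      ((LinearIsometryEquiv.continuous _).measurable.comp (measurable_fderiv ℝ h))
      measurable_const
  · intro v
    split_ifs with hv
    · rw [← key v hv (a v) (haX v) (ha v)]
      exact haX v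
    · exact hx₀
  · filter_upwards [hlip.ae_differentiableAt (μ := volume)] with v hv u hu hmin
    rw [if_pos hv]
    exact key v hv u hu hmin

theorem IsArgminSelection.ae_le {d : ℕ} {X : Set (E d)} {s : E d → E d}
    (hs : IsArgminSelection X s) (hX : IsCompact X) (hne : X.Nonempty) :
    ∀ᵐ v, ∀ u ∈ X, (inner ℝ v (s v) : ℝ) ≤ inner ℝ v u := by
  filter_upwards [hs.ae_eq] with v hv u hu
  obtain ⟨a, haX, ha⟩ := hX.exists_isMinOn hne
    (f := fun u => (inner ℝ v u : ℝ)) (by fun_prop)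
  rw [← hv a haX ha]
  exact ha hu

/-! ### Uniform measures on balls and their translates. -/

section UniformBall

variable {d : ℕ} {R : ℝ}

theorem uniformBall_eq (hR : 0 < R) :
    uniformBall d R = (volume (Metric.closedBall (0 : E d) R))⁻¹ •
      volume.restrict (Metric.closedBall (0 : E d) R) := by
  rw [uniformBall, if_pos hR, ProbabilityTheory.cond]

theorem isProbabilityMeasure_uniformBall (hR : 0 < R) :
    IsProbabilityMeasure (uniformBall d R) := by
  rw [uniformBall, if_pos hR]
  exact cond_isProbabilityMeasure_of_finite
    (Metric.measure_closedBall_pos _ _ hR).ne' measure_closedBall_lt_top.ne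

theorem uniformBall_absolutelyContinuous (hR : 0 < R) : uniformBall d R ≪ volume := by
  rw [uniformBall, if_pos hR]
  exact cond_absolutelyContinuous

theorem ae_norm_le_uniformBall (hR : 0 < R) : ∀ᵐ z ∂(uniformBall d R), ‖z‖ ≤ R := by
  rw [uniformBall_eq hR]
  refine Measure.ae_smul_measure ?_ _
  filter_upwards [ae_restrict_mem Metric.isClosed_closedBall.measurableSet] with z hz
  simpa using hz

theorem ae_uniformBall_sub_left (hR : 0 < R) {p : E d → Prop} (hp : ∀ᵐ w, p w) (v : E d) :
    ∀ᵐ z ∂(uniformBall d R), p (v - z) := by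
  refine (uniformBall_absolutelyContinuous hR).ae_le ?_
  exact (Measure.measurePreserving_sub_left volume v).quasiMeasurePreserving.ae hp

theorem integral_uniformBall_sub_left (hR : 0 < R) (F : E d → E d) (v : E d) :
    ∫ z, F (v - z) ∂(uniformBall d R) =
      (volume.real (Metric.closedBall (0 : E d) R))⁻¹ • ∫ w in Metric.closedBall v R, F w := by
  rw [uniformBall_eq hR, integral_smul_measure, ENNReal.toReal_inv]
  congr 1
  have := (Measure.measurePreserving_sub_left volume v).setIntegral_preimage_emb
    (MeasurableEquiv.subLeft v).measurableEmbedding F (Metric.closedBall v R)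
  rw [← this]
  congr 2
  ext z
  simp [dist_eq_norm]

/-- Both balls contain the ball of radius R - ‖v - w‖/2 about the midpoint, and Bernoulli's
inequality bounds the volume left over. Centring at the midpoint rather than at v saves a factor 2.
For distant centres the right side already exceeds the full volume, since d ≥ 1. -/
theorem volume_closedBall_diff_le (hd : 0 < d) (hR : 0 < R) (v w : E d) :
    volume.real (Metric.closedBall v R \ Metric.closedBall w R) ≤
      d * ‖v - w‖ / (2 * R) * volume.real (Metric.closedBall (0 : E d) R) := by
  set V := volume.real (Metric.closedBall (0 : E d) R)
  have hvol (x : E d) {r : ℝ} (hr : 0 ≤ r) :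
      volume.real (Metric.closedBall x r) = (r / R) ^ d * V := by
    rw [measureReal_def, Measure.addHaar_closedBall' _ _ hr, ENNReal.toReal_mul]
    simp only [V]
    rw [measureReal_def, Measure.addHaar_closedBall' _ _ hR.le, ENNReal.toReal_mul]
    simp only [finrank_euclideanSpace, Fintype.card_fin]
    rw [ENNReal.toReal_ofReal (by positivity), ENNReal.toReal_ofReal (by positivity), div_pow]
    field_simp
  have hVv : volume.real (Metric.closedBall v R) = V := by
    rw [hvol v hR.le, div_self hR.ne', one_pow, one_mul]
  have hV0 : 0 ≤ V := measureReal_nonneg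
  by_cases hcase : ‖v - w‖ ≤ 2 * R
  · set r := R - ‖v - w‖ / 2 with hr
    have hr0 : 0 ≤ r := by linarith
    set c := midpoint ℝ v w
    have hcv : dist c v = ‖v - w‖ / 2 := by
      rw [dist_midpoint_left, dist_eq_norm]; norm_num; ring
    have hcw : dist c w = ‖v - w‖ / 2 := by
      rw [dist_midpoint_right, dist_eq_norm]; norm_num; ring
    have h1 : Metric.closedBall c r ⊆ Metric.closedBall v R :=
      Metric.closedBall_subset_closedBall' (by linarith)
    have h2 : Metric.closedBall c r ⊆ Metric.closedBall w R :=
      Metric.closedBall_subset_closedBall' (by linarith)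
    calc volume.real (Metric.closedBall v R \ Metric.closedBall w R)
        ≤ volume.real (Metric.closedBall v R \ Metric.closedBall c r) :=
          measureReal_mono (Set.sdiff_subset_sdiff_right h2)
            ((measure_mono Set.sdiff_subset).trans_lt measure_closedBall_lt_top).ne
      _ = V - (r / R) ^ d * V := by
          rw [measureReal_sdiff h1 Metric.isClosed_closedBall.measurableSet
            measure_closedBall_lt_top.ne, hVv, hvol c hr0]
      _ ≤ d * ‖v - w‖ / (2 * R) * V := by
          have hb := one_add_mul_le_pow (a := -(‖v - w‖ / (2 * R)))
            (by
              have : ‖v - w‖ / (2 * R) ≤ 1 := (div_le_one (by positivity)).2 hcase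
              linarith) d
          have he : r / R = 1 + -(‖v - w‖ / (2 * R)) := by
            rw [hr]; field_simp; ring
          rw [he]
          have : 1 - (1 + -(‖v - w‖ / (2 * R))) ^ d ≤ d * ‖v - w‖ / (2 * R) := by
            have : (d : ℝ) * -(‖v - w‖ / (2 * R)) = -(d * ‖v - w‖ / (2 * R)) := by ring
            linarith
          nlinarith
  · push Not at hcase
    have h1 : 1 ≤ d * ‖v - w‖ / (2 * R) := by
      rw [le_div_iff₀ (by positivity)]
      have : (1 : ℝ) ≤ d := by exact_mod_cast hd
      nlinarith [norm_nonneg (v - w)]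
    calc volume.real (Metric.closedBall v R \ Metric.closedBall w R)
        ≤ volume.real (Metric.closedBall v R) :=
          measureReal_mono Set.sdiff_subset measure_closedBall_lt_top.ne
      _ = 1 * V := by rw [hVv, one_mul]
      _ ≤ _ := by gcongr

end UniformBall

/-! ### The smoothed support function and its supergradient. -/

/-- The expectation of the perturbed action in the direction `v`. -/
noncomputable def meanAction {d : ℕ} (R : ℝ) (s : E d → E d) (v : E d) : E d :=
  ∫ z, s (v - z) ∂(uniformBall d R)

/-- The expectation of the perturbed optimal value in the direction `v`. -/
noncomputable def meanValue {d : ℕ} (R : ℝ) (s : E d → E d) (v : E d) : ℝ :=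
  ∫ z, inner ℝ (v - z) (s (v - z)) ∂(uniformBall d R)

section Smoothing

variable {d : ℕ} {R D : ℝ} {X : Set (E d)} {s : E d → E d}

theorem integrable_of_mem_isCompact {Ω : Type*} [MeasurableSpace Ω] {P : Measure Ω}
    [IsFiniteMeasure P] (hX : IsCompact X) {F : Ω → E d} (hF : Measurable F)
    (hmem : ∀ ω, F ω ∈ X) : Integrable F P := by
  obtain ⟨C, hC⟩ := hX.isBounded.exists_norm_le
  exact Integrable.of_bound hF.aestronglyMeasurable C (.of_forall fun ω => hC _ (hmem ω))

theorem integrable_action (hs : IsArgminSelection X s) (hX : IsCompact X) (hR : 0 < R) (v : E d) :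
    Integrable (fun z => s (v - z)) (uniformBall d R) := by
  have := isProbabilityMeasure_uniformBall (d := d) hR
  exact integrable_of_mem_isCompact hX (hs.measurable.comp (by fun_prop)) fun z => hs.mem _

theorem integrable_inner_action (hs : IsArgminSelection X s) (hX : IsCompact X) (hR : 0 < R)
    (a b : E d) : Integrable (fun z => (inner ℝ (a - z) (s (b - z)) : ℝ)) (uniformBall d R) := by
  have := isProbabilityMeasure_uniformBall (d := d) hR
  obtain ⟨C, hC⟩ := hX.isBounded.exists_norm_le
  refine Integrable.of_bound (C := (‖a‖ + R) * C) ?_ ?_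
  · have := hs.measurable
    exact Measurable.aestronglyMeasurable (by fun_prop)
  · filter_upwards [ae_norm_le_uniformBall hR] with z hz
    refine (norm_inner_le_norm _ _).trans ?_
    gcongr
    · exact (norm_sub_le _ _).trans (by gcongr)
    · exact hC _ (hs.mem _)

theorem meanAction_mem (hs : IsArgminSelection X s) (hX : IsCompact X) (hc : Convex ℝ X)
    (hR : 0 < R) (v : E d) : meanAction R s v ∈ X := by
  have := isProbabilityMeasure_uniformBall (d := d) hR
  exact hc.integral_mem hX.isClosed (.of_forall fun z => hs.mem _) (integrable_action hs hX hR v)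

/-- Both means are normalized integrals of s over translated balls. The common part cancels, and
each of the two set differences contributes at most half of the bound. -/
theorem norm_meanAction_sub_le (hs : IsArgminSelection X s) (hX : IsCompact X) (hd : 0 < d)
    (hR : 0 < R) (hD : Metric.diam X ≤ D) (v w : E d) :
    ‖meanAction R s v - meanAction R s w‖ ≤ d * D / R * ‖v - w‖ := by
  have hdiam (x y : E d) (hx : x ∈ X) (hy : y ∈ X) : ‖x - y‖ ≤ D := by
    rw [← dist_eq_norm]
    exact (Metric.dist_le_diam_of_mem hX.isBounded hx hy).trans hD
  have hprob := isProbabilityMeasure_uniformBall (d := d) hR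
  set x₀ := s 0
  -- Subtracting a point of X makes the integrand bounded by the diameter instead of by the norms of
  -- points of X.
  set F : E d → E d := fun z => s z - x₀ with hF
  have hD0 : 0 ≤ D := Metric.diam_nonneg.trans hD
  have hFb (z : E d) : ‖F z‖ ≤ D := hdiam _ _ (hs.mem _) (hs.mem _)
  have hmean (u : E d) : meanAction R s u = x₀ +
      (volume.real (Metric.closedBall (0 : E d) R))⁻¹ • ∫ w in Metric.closedBall u R, F w := by
    rw [← integral_uniformBall_sub_left hR, hF, integral_sub (integrable_action hs hX hR u)
      (integrable_const _)]
    simp [meanAction]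
  have hint (u : E d) : IntegrableOn F (Metric.closedBall u R) :=
    IntegrableOn.of_bound measure_closedBall_lt_top
      (hs.measurable.sub_const _).aestronglyMeasurable D (.of_forall hFb)
  set V := volume.real (Metric.closedBall (0 : E d) R)
  have hV : 0 < V := by
    refine ENNReal.toReal_pos (Metric.measure_closedBall_pos _ _ hR).ne'
      measure_closedBall_lt_top.ne
  have hbound (a b : E d) : ‖∫ z in Metric.closedBall a R \ Metric.closedBall b R, F z‖ ≤
      D * (d * ‖a - b‖ / (2 * R) * V) := by
    refine (norm_setIntegral_le_of_norm_le_const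
      ((measure_mono Set.sdiff_subset).trans_lt measure_closedBall_lt_top)
      fun z _ => hFb z).trans ?_
    gcongr
    exact volume_closedBall_diff_le hd hR a b
  have hsplit : (∫ z in Metric.closedBall v R, F z) - ∫ z in Metric.closedBall w R, F z =
      (∫ z in Metric.closedBall v R \ Metric.closedBall w R, F z) -
        ∫ z in Metric.closedBall w R \ Metric.closedBall v R, F z := by
    rw [← integral_inter_add_sdiff Metric.isClosed_closedBall.measurableSet (hint v)
      (t := Metric.closedBall w R),
      ← integral_inter_add_sdiff Metric.isClosed_closedBall.measurableSet (hint w)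
      (t := Metric.closedBall v R), Set.inter_comm]
    abel
  rw [hmean, hmean, add_sub_add_left_eq_sub, ← smul_sub, hsplit, norm_smul, norm_inv,
    Real.norm_of_nonneg hV.le]
  calc V⁻¹ * ‖(∫ z in Metric.closedBall v R \ Metric.closedBall w R, F z) -
        ∫ z in Metric.closedBall w R \ Metric.closedBall v R, F z‖
      ≤ V⁻¹ * (D * (d * ‖v - w‖ / (2 * R) * V) + D * (d * ‖w - v‖ / (2 * R) * V)) := by
        gcongr
        exact (norm_sub_le _ _).trans (add_le_add (hbound v w) (hbound w v))
    _ = d * D / R * ‖v - w‖ := by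
        rw [norm_sub_rev w v]
        field_simp
        ring

theorem continuous_meanAction (hs : IsArgminSelection X s) (hX : IsCompact X) (hd : 0 < d)
    (hR : 0 < R) : Continuous (meanAction R s) := by
  refine (LipschitzWith.of_dist_le_mul (K := (d * Metric.diam X / R).toNNReal)
    fun v w => ?_).continuous
  rw [Real.coe_toNNReal _ (div_nonneg (mul_nonneg d.cast_nonneg Metric.diam_nonneg) hR.le),
    dist_eq_norm, dist_eq_norm]
  exact norm_meanAction_sub_le hs hX hd hR le_rfl v w

/-- The action chosen for a - z is an admissible competitor in the direction b - z; averaging over z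
gives the supergradient inequality. -/
theorem meanValue_le_add_inner (hs : IsArgminSelection X s) (hX : IsCompact X) (hR : 0 < R)
    (a b : E d) :
    meanValue R s b ≤ meanValue R s a + inner ℝ (meanAction R s a) (b - a) := by
  have hne : X.Nonempty := ⟨_, hs.mem 0⟩
  have hi := integrable_action hs hX hR a
  have h1 : (inner ℝ (meanAction R s a) (b - a) : ℝ) =
      ∫ z, inner ℝ (b - a) (s (a - z)) ∂(uniformBall d R) := by
    rw [integral_inner hi, real_inner_comm]
    rfl
  rw [h1, meanValue, meanValue,
    ← integral_add (integrable_inner_action hs hX hR a a) (hi.const_inner _)]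
  refine integral_mono_ae (integrable_inner_action hs hX hR b b)
    ((integrable_inner_action hs hX hR a a).add (hi.const_inner _)) ?_
  filter_upwards [ae_uniformBall_sub_left hR (hs.ae_le hX hne) b] with z hz
  have := hz _ (hs.mem (a - z))
  rwa [← inner_add_left, show a - z + (b - a) = b - z by abel]

/-- Co-coercivity of a Lipschitz supergradient, obtained by passing from a to b through one
intermediate point. This loses a constant factor but needs neither differentiation nor integration
along segments. -/
theorem meanValue_le_add_inner_sub_sq (hs : IsArgminSelection X s) (hX : IsCompact X) (hd : 0 < d)
    (hR : 0 < R) (hD : Metric.diam X ≤ D) (hD0 : 0 < D) (a b : E d) :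
    meanValue R s b ≤ meanValue R s a + inner ℝ (meanAction R s a) (b - a) -
      R / (4 * d * D) * ‖meanAction R s a - meanAction R s b‖ ^ 2 := by
  set α := d * D / R with hα
  have hd' : (0 : ℝ) < d := by exact_mod_cast hd
  have hα0 : 0 < α := by positivity
  set p := meanAction R s a
  set q := meanAction R s b
  -- A step of length c along p - q gains c - αc² times ‖p - q‖²; the maximum is at c = 1/(2α), with
  -- value 1/(4α).
  set z := b - (2 * α)⁻¹ • (p - q) with hz
  have h1 := meanValue_le_add_inner hs hX hR a z
  have h2 := meanValue_le_add_inner hs hX hR z b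
  have h3 := norm_meanAction_sub_le hs hX hd hR hD z b
  have e1 : b - z = (2 * α)⁻¹ • (p - q) := by rw [hz]; abel
  have e2 : z - a = (b - a) - (2 * α)⁻¹ • (p - q) := by rw [hz]; abel
  rw [e2, inner_sub_right, inner_smul_right] at h1
  set r := meanAction R s z
  have h4 : (inner ℝ r (b - z) : ℝ) ≤ (2 * α)⁻¹ * inner ℝ q (p - q) + α * ‖b - z‖ ^ 2 := by
    have : (inner ℝ (r - q) (b - z) : ℝ) ≤ α * ‖b - z‖ ^ 2 := by
      refine (real_inner_le_norm _ _).trans ?_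
      rw [norm_sub_rev z b] at h3
      nlinarith [norm_nonneg (b - z)]
    rw [inner_sub_left] at this
    have h5 : (inner ℝ q (b - z) : ℝ) = (2 * α)⁻¹ * inner ℝ q (p - q) := by
      rw [e1, inner_smul_right]
    linarith
  have h6 : ‖b - z‖ ^ 2 = (2 * α)⁻¹ ^ 2 * ‖p - q‖ ^ 2 := by
    rw [e1, norm_smul, Real.norm_of_nonneg (by positivity), mul_pow]
  have h7 : (2 * α)⁻¹ * (inner ℝ p (p - q) : ℝ) - (2 * α)⁻¹ * inner ℝ q (p - q) =
      (2 * α)⁻¹ * ‖p - q‖ ^ 2 := by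
    rw [← mul_sub, ← inner_sub_left, real_inner_self_eq_norm_sq]
  have h8 : (2 * α)⁻¹ - α * (2 * α)⁻¹ ^ 2 = R / (4 * d * D) := by
    rw [hα]; field_simp; ring
  rw [← h8, sub_mul]
  rw [h6] at h4
  linarith

/-- Comparison with a fixed u ends the telescoping; the perturbation, of norm at most R, costs R
times the diameter. -/
theorem meanValue_sub_meanValue_zero_le (hs : IsArgminSelection X s) (hX : IsCompact X)
    (hR : 0 < R) (hD : Metric.diam X ≤ D) (a u : E d) (hu : u ∈ X) :
    meanValue R s a - meanValue R s 0 ≤ inner ℝ a u + R * D := by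
  have := isProbabilityMeasure_uniformBall (d := d) hR
  have hne : X.Nonempty := ⟨_, hs.mem 0⟩
  have hia := integrable_inner_action hs hX hR a a
  have hi0 := integrable_inner_action hs hX hR 0 0
  rw [meanValue, meanValue, ← integral_sub hia hi0]
  have hc : (inner ℝ a u + R * D : ℝ) = ∫ _, (inner ℝ a u + R * D : ℝ) ∂(uniformBall d R) := by
    simp
  rw [hc]
  refine integral_mono_ae (hia.sub hi0) (integrable_const _) ?_
  filter_upwards [ae_uniformBall_sub_left hR (hs.ae_le hX hne) a, ae_norm_le_uniformBall hR]
    with z hz hzR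
  have h1 := hz u hu
  have h2 : (inner ℝ z (s (0 - z) - u) : ℝ) ≤ R * D := by
    refine (real_inner_le_norm _ _).trans ?_
    gcongr
    rw [← dist_eq_norm]
    exact (Metric.dist_le_diam_of_mem hX.isBounded (hs.mem _) hu).trans hD
  rw [inner_sub_right] at h2
  have h4 : (inner ℝ (a - z) u : ℝ) = inner ℝ a u - inner ℝ z u := inner_sub_left _ _ _
  have h3 : (inner ℝ (0 - z) (s (0 - z)) : ℝ) = - inner ℝ z (s (0 - z)) := by
    rw [zero_sub, inner_neg_left]
  rw [h3]
  linarith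

end Smoothing

/-! ### Concentration of averages of sampled actions. -/

/-- The average of the actions for the direction `v` and the perturbations `ζ`. -/
noncomputable def sampleMean {d m : ℕ} (s : E d → E d) (v : E d) (ζ : Fin m → E d) : E d :=
  (m : ℝ)⁻¹ • ∑ j, s (v - ζ j)

section Gaussian

variable {d : ℕ}

theorem lintegral_exp_neg_mul_sq_norm_add_inner {b : ℝ} (hb : 0 < b) (w : E d) :
    ∫⁻ θ : E d, ENNReal.ofReal (Real.exp (-b * ‖θ‖ ^ 2 + inner ℝ w θ)) =
      ENNReal.ofReal ((Real.pi / b) ^ (d / 2 : ℝ) * Real.exp (‖w‖ ^ 2 / (4 * b))) := by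
  have hb' : 0 < (b : ℂ).re := by simpa using hb
  have hcast (θ : E d) : Complex.exp (-(b : ℂ) * ‖θ‖ ^ 2 + 1 * (inner ℝ w θ : ℝ)) =
      ((Real.exp (-b * ‖θ‖ ^ 2 + inner ℝ w θ) : ℝ) : ℂ) := by
    push_cast
    rw [one_mul]
  have hint := GaussianFourier.integrable_cexp_neg_mul_sq_norm_add hb' 1 w
  have heq := GaussianFourier.integral_cexp_neg_mul_sq_norm_add hb' 1 w
  simp_rw [hcast] at hint heq
  rw [integral_complex_ofReal] at heq
  rw [← ofReal_integral_eq_lintegral_ofReal]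
  · congr 1
    rw [← Complex.ofReal_inj, heq]
    push_cast
    rw [Complex.ofReal_cpow (by positivity)]
    simp
  · exact hint.re
  · exact .of_forall fun _ => (Real.exp_pos _).le

/-- Gaussian linearization: exp(‖N‖²/(8κ)) is a Gaussian average of exp⟨θ, N⟩. After exchanging the
integrals, the assumed bound cancels half of the exponent 2κ‖θ‖², and the ratio of the two Gaussian
normalizations is 2^(d/2). -/
theorem lintegral_exp_sq_norm_le {Ω : Type*} [MeasurableSpace Ω] {P : Measure Ω} [SFinite P]
    {N : Ω → E d} (hN : Measurable N) {κ : ℝ} (hκ : 0 < κ)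
    (h : ∀ θ : E d, ∫⁻ ω, ENNReal.ofReal (Real.exp (inner ℝ θ (N ω))) ∂P ≤
      ENNReal.ofReal (Real.exp (κ * ‖θ‖ ^ 2))) :
    ∫⁻ ω, ENNReal.ofReal (Real.exp (‖N ω‖ ^ 2 / (8 * κ))) ∂P ≤
      ENNReal.ofReal (2 ^ (d / 2 : ℝ)) := by
  set c : ℝ := (Real.pi / (2 * κ)) ^ (d / 2 : ℝ) with hc
  have hc0 : 0 < c := by positivity
  have h1 (ω : Ω) : ENNReal.ofReal (Real.exp (‖N ω‖ ^ 2 / (8 * κ))) =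
      ENNReal.ofReal c⁻¹ *
        ∫⁻ θ : E d, ENNReal.ofReal (Real.exp (-(2 * κ) * ‖θ‖ ^ 2 + inner ℝ (N ω) θ)) := by
    rw [lintegral_exp_neg_mul_sq_norm_add_inner (by positivity), ← hc,
      ← ENNReal.ofReal_mul (by positivity), inv_mul_cancel_left₀ hc0.ne', show 4 * (2 * κ) = 8 * κ by ring]
  simp_rw [h1]
  rw [lintegral_const_mul' _ _ ENNReal.ofReal_ne_top, lintegral_lintegral_swap]
  swap
  · exact Measurable.aemeasurable (by unfold Function.uncurry; fun_prop)
  calc ENNReal.ofReal c⁻¹ * ∫⁻ θ : E d, ∫⁻ ω,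
        ENNReal.ofReal (Real.exp (-(2 * κ) * ‖θ‖ ^ 2 + inner ℝ (N ω) θ)) ∂P
      ≤ ENNReal.ofReal c⁻¹ * ∫⁻ θ : E d,
          ENNReal.ofReal (Real.exp (-κ * ‖θ‖ ^ 2 + inner ℝ (0 : E d) θ)) := by
        gcongr with θ
        simp_rw [Real.exp_add, ENNReal.ofReal_mul (Real.exp_pos _).le]
        rw [lintegral_const_mul' _ _ ENNReal.ofReal_ne_top]
        calc _ ≤ ENNReal.ofReal (Real.exp (-(2 * κ) * ‖θ‖ ^ 2)) *
              ENNReal.ofReal (Real.exp (κ * ‖θ‖ ^ 2)) := by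
              gcongr
              simp_rw [real_inner_comm θ]
              exact h θ
          _ = _ := by
              rw [← ENNReal.ofReal_mul (Real.exp_pos _).le, ← Real.exp_add]
              simp
              ring_nf
    _ = ENNReal.ofReal (2 ^ (d / 2 : ℝ)) := by
        rw [lintegral_exp_neg_mul_sq_norm_add_inner hκ, ← ENNReal.ofReal_mul (by positivity)]
        congr 1
        rw [hc, ← Real.inv_rpow (by positivity)]
        simp only [norm_zero, ne_eq, OfNat.ofNat_ne_zero, not_false_eq_true, zero_pow, zero_div,
          Real.exp_zero, mul_one]
        rw [← Real.mul_rpow (by positivity) (by positivity)]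
        congr 1
        have := Real.pi_pos
        field_simp

end Gaussian

section SampleMean

variable {d m : ℕ} {R D : ℝ} {X : Set (E d)} {s : E d → E d}

theorem sampleMean_mem (hs : IsArgminSelection X s) (hc : Convex ℝ X) (hm : 0 < m) (v : E d)
    (ζ : Fin m → E d) : sampleMean s v ζ ∈ X := by
  rw [sampleMean, Finset.smul_sum]
  refine hc.sum_mem (fun _ _ => by positivity) ?_ fun _ _ => hs.mem _
  have : (m : ℝ) ≠ 0 := by positivity
  simp [this]

theorem measurable_sampleMean (hs : IsArgminSelection X s) :
    Measurable fun p : E d × (Fin m → E d) => sampleMean s p.1 p.2 := by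
  have := hs.measurable
  unfold sampleMean
  fun_prop

/-- Hoeffding's lemma: on X the functional ⟨θ, ·⟩ takes values in an interval of length ‖θ‖D. -/
theorem lintegral_exp_inner_action_le (hs : IsArgminSelection X s) (hX : IsCompact X)
    (hR : 0 < R) (hD : Metric.diam X ≤ D) (v θ : E d) :
    ∫⁻ z, ENNReal.ofReal (Real.exp (inner ℝ θ (s (v - z) - meanAction R s v)))
      ∂(uniformBall d R) ≤ ENNReal.ofReal (Real.exp (‖θ‖ ^ 2 * D ^ 2 / 8)) := by
  have := isProbabilityMeasure_uniformBall (d := d) hR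
  obtain ⟨u, huX, hu⟩ := hX.exists_isMinOn ⟨_, hs.mem 0⟩
    (f := fun u => (inner ℝ θ u : ℝ)) (by fun_prop)
  have hsm := hs.measurable
  have hD0 : 0 ≤ D := Metric.diam_nonneg.trans hD
  have hsub := hasSubgaussianMGF_of_mem_Icc (μ := uniformBall d R)
    (X := fun z => (inner ℝ θ (s (v - z)) : ℝ)) (a := inner ℝ θ u)
    (b := inner ℝ θ u + ‖θ‖ * D) (by fun_prop) (.of_forall fun z => ⟨hu (hs.mem _), by
      have : (inner ℝ θ (s (v - z) - u) : ℝ) ≤ ‖θ‖ * D := by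
        refine (real_inner_le_norm _ _).trans ?_
        gcongr
        rw [← dist_eq_norm]
        exact (Metric.dist_le_diam_of_mem hX.isBounded (hs.mem _) huX).trans hD
      rw [inner_sub_right] at this
      linarith⟩)
  have hmean : ∫ z, (inner ℝ θ (s (v - z)) : ℝ) ∂(uniformBall d R) =
      inner ℝ θ (meanAction R s v) := integral_inner (integrable_action hs hX hR v) θ
  rw [hmean] at hsub
  have h1 := hsub.mgf_le 1
  have h2 := hsub.integrable_exp_mul 1
  simp only [one_mul, mgf, ← inner_sub_right] at h1 h2
  rw [← ofReal_integral_eq_lintegral_ofReal h2 (.of_forall fun _ => (Real.exp_pos _).le)]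
  refine ENNReal.ofReal_le_ofReal (h1.trans_eq ?_)
  congr 1
  simp only [add_sub_cancel_left, NNReal.coe_pow, NNReal.coe_div, coe_nnnorm, Real.norm_eq_abs,
    NNReal.coe_ofNat, one_pow, mul_one]
  rw [abs_of_nonneg (by positivity)]
  ring

/-- By independence the moment is a product of m moments at θ/m, so averaging gains a factor 1/m in
the exponent. -/
theorem lintegral_exp_inner_sampleMean_le (hs : IsArgminSelection X s) (hX : IsCompact X)
    (hR : 0 < R) (hD : Metric.diam X ≤ D) (hm : 0 < m) (v θ : E d) :
    ∫⁻ ζ, ENNReal.ofReal (Real.exp (inner ℝ θ (sampleMean s v ζ - meanAction R s v)))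
      ∂(Measure.pi fun _ : Fin m => uniformBall d R) ≤
        ENNReal.ofReal (Real.exp (D ^ 2 / (8 * m) * ‖θ‖ ^ 2)) := by
  have := isProbabilityMeasure_uniformBall (d := d) hR
  have hm' : (0 : ℝ) < m := by exact_mod_cast hm
  have hsm := hs.measurable
  have hprod (ζ : Fin m → E d) :
      ENNReal.ofReal (Real.exp (inner ℝ θ (sampleMean s v ζ - meanAction R s v))) =
        ∏ j, ENNReal.ofReal
          (Real.exp (inner ℝ ((m : ℝ)⁻¹ • θ) (s (v - ζ j) - meanAction R s v))) := by
    rw [← ENNReal.ofReal_prod_of_nonneg fun _ _ => (Real.exp_pos _).le, ← Real.exp_sum]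
    congr 2
    rw [← inner_sum, Finset.sum_sub_distrib, inner_smul_left]
    simp only [sampleMean, Finset.sum_const, Finset.card_univ, Fintype.card_fin, inner_sub_right,
      inner_smul_right, ← Nat.cast_smul_eq_nsmul ℝ, conj_trivial]
    field_simp
  have hmeas : Measurable fun z => ENNReal.ofReal
      (Real.exp (inner ℝ ((m : ℝ)⁻¹ • θ) (s (v - z) - meanAction R s v))) := by fun_prop
  simp_rw [hprod]
  rw [lintegral_prod_eq_prod_lintegral_of_indepFun Finset.univ _
    (iIndepFun_pi fun _ : Fin m => hmeas.aemeasurable) fun j => hmeas.comp (measurable_pi_apply j)]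
  simp_rw [(measurePreserving_eval (fun _ : Fin m => uniformBall d R) _).lintegral_comp hmeas]
  refine (Finset.prod_le_prod' fun j _ =>
    lintegral_exp_inner_action_le hs hX hR hD v _).trans_eq ?_
  rw [Finset.prod_const, ← ENNReal.ofReal_pow (Real.exp_pos _).le, ← Real.exp_nat_mul,
    Finset.card_univ, Fintype.card_fin, norm_smul, norm_inv, Real.norm_natCast]
  congr 2
  field_simp

theorem lintegral_exp_sq_norm_sampleMean_le (hs : IsArgminSelection X s) (hX : IsCompact X)
    (hR : 0 < R) (hD : Metric.diam X ≤ D) (hD0 : 0 < D) (hm : 0 < m) (v : E d) :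
    ∫⁻ ζ, ENNReal.ofReal (Real.exp (m / D ^ 2 * ‖sampleMean s v ζ - meanAction R s v‖ ^ 2))
      ∂(Measure.pi fun _ : Fin m => uniformBall d R) ≤ ENNReal.ofReal (2 ^ (d / 2 : ℝ)) := by
  have := isProbabilityMeasure_uniformBall (d := d) hR
  have hm' : (0 : ℝ) < m := by exact_mod_cast hm
  have hmeas : Measurable fun ζ : Fin m → E d => sampleMean s v ζ - meanAction R s v :=
    ((measurable_sampleMean hs).comp measurable_prodMk_left).sub_const _
  convert lintegral_exp_sq_norm_le hmeas (κ := D ^ 2 / (8 * m)) (by positivity)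
    (lintegral_exp_inner_sampleMean_le hs hX hR hD hm v) using 5
  field_simp

end SampleMean

/-! ### The iterates as explicit functions of the perturbations. -/

/-- The averages of the actions of both players for the directions `v`. -/
noncomputable def action {d m : ℕ} (sx sy : E d → E d) (v : E d × E d) (ζx ζy : Fin m → E d) :
    E d × E d :=
  (sampleMean sx v.1 ζx, sampleMean sy v.2 ζy)

/-- The expected actions of both players for the directions `v`. -/
noncomputable def meanPoint {d : ℕ} (R : ℝ) (sx sy : E d → E d) (v : E d × E d) : E d × E d :=
  (meanAction R sx v.1, meanAction R sy v.2)

section Iterates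

variable {d m : ℕ} (F : E d × E d → E d × E d) (sx sy : E d → E d)
  (ζ : Player → Stage → ℕ → Fin m → E d)

/-- The sums of the gradients that the players have observed before round `t`, if they play with
the selections `sx`, `sy` and the perturbations `ζ` and the gradients are given by `F`. -/
noncomputable def gradSum : ℕ → E d × E d
  | 0 => 0
  | t + 1 => gradSum t + F (action sx sy
      (gradSum t + if t = 0 then 0 else
        F (action sx sy (gradSum t) (ζ .xPlayer .guess t) (ζ .yPlayer .guess t)))
      (ζ .xPlayer .play t) (ζ .yPlayer .play t))

/-- The predicted actions in round `t`. -/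
noncomputable def guessPoint (t : ℕ) : E d × E d :=
  action sx sy (gradSum F sx sy ζ t) (ζ .xPlayer .guess t) (ζ .yPlayer .guess t)

/-- The guessed gradients in round `t`. -/
noncomputable def guessGrad (t : ℕ) : E d × E d :=
  if t = 0 then 0 else F (guessPoint F sx sy ζ t)

/-- The directions in which the players optimize in round `t`. -/
noncomputable def playDir (t : ℕ) : E d × E d :=
  gradSum F sx sy ζ t + guessGrad F sx sy ζ t

/-- The actions played in round `t`. -/
noncomputable def playPoint (t : ℕ) : E d × E d :=
  action sx sy (playDir F sx sy ζ t) (ζ .xPlayer .play t) (ζ .yPlayer .play t)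

theorem gradSum_succ (t : ℕ) :
    gradSum F sx sy ζ (t + 1) = gradSum F sx sy ζ t + F (playPoint F sx sy ζ t) := rfl

theorem gradSum_eq_sum (t : ℕ) :
    gradSum F sx sy ζ t = ∑ i ∈ Finset.range t, F (playPoint F sx sy ζ i) := by
  induction t with
  | zero => rfl
  | succ t ih => rw [gradSum_succ, Finset.sum_range_succ, ih]

/-- The first-order effect in round `t` of the deviation of the actions from their means. -/
noncomputable def linearNoise (R : ℝ) (t : ℕ) : ℝ :=
  inner ℝ (F (meanPoint R sx sy (playDir F sx sy ζ t))).1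
      ((playPoint F sx sy ζ t).1 - meanAction R sx (playDir F sx sy ζ t).1) +
    inner ℝ (F (meanPoint R sx sy (playDir F sx sy ζ t))).2
      ((playPoint F sx sy ζ t).2 - meanAction R sy (playDir F sx sy ζ t).2)

/-- The total squared deviation of the actions and predicted actions of round `t` from their
means. -/
noncomputable def squaredNoise (R : ℝ) (t : ℕ) : ℝ :=
  ‖(guessPoint F sx sy ζ t).1 - meanAction R sx (gradSum F sx sy ζ t).1‖ ^ 2 +
    ‖(guessPoint F sx sy ζ t).2 - meanAction R sy (gradSum F sx sy ζ t).2‖ ^ 2 +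
    ‖(playPoint F sx sy ζ t).1 - meanAction R sx (playDir F sx sy ζ t).1‖ ^ 2 +
    ‖(playPoint F sx sy ζ t).2 - meanAction R sy (playDir F sx sy ζ t).2‖ ^ 2

end Iterates

/-! ### Deterministic regret bound. -/

/-- One optimistic round: a is the sum of past gradients, b - a the guess, g the gradient revealed.
The co-coercive inequality is used from a + g to b and from b to a, so that the potential at b
cancels. -/
theorem inner_meanAction_le {d : ℕ} {R D : ℝ} {X : Set (E d)} {s : E d → E d}
    (hs : IsArgminSelection X s) (hX : IsCompact X) (hd : 0 < d) (hR : 0 < R)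
    (hD : Metric.diam X ≤ D) (hD0 : 0 < D) (a b g : E d) :
    inner ℝ g (meanAction R s b) ≤ meanValue R s (a + g) - meanValue R s a +
      inner ℝ (g - (b - a)) (meanAction R s b - meanAction R s (a + g)) -
      R / (4 * d * D) * ‖meanAction R s b - meanAction R s (a + g)‖ ^ 2 -
      R / (4 * d * D) * ‖meanAction R s b - meanAction R s a‖ ^ 2 := by
  have h1 := meanValue_le_add_inner_sub_sq hs hX hd hR hD hD0 (a + g) b
  have h2 := meanValue_le_add_inner_sub_sq hs hX hd hR hD hD0 b a
  rw [norm_sub_rev (meanAction R s (a + g))] at h1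
  set p := meanAction R s b
  set q := meanAction R s (a + g)
  have e1 : (inner ℝ q (b - (a + g)) : ℝ) + inner ℝ p (a - b) =
      inner ℝ (g - (b - a)) (p - q) - inner ℝ g p := by
    simp only [inner_sub_left, inner_sub_right, inner_add_right, real_inner_comm]
    ring
  linarith

/-- Young's inequality for the guess error against the change of action. The threshold 3L/2 for β =
R/(4dD) is the source of the requirement R ≥ 6dDL, hence of the 6 in η. -/
theorem mul_add_mul_le_of_add_le {L β a a' b b' g g' n₁ n₂ n₃ n₄ : ℝ} (hL : 0 ≤ L)
    (hβ : 3 / 2 * L ≤ β) (ha : 0 ≤ a) (ha' : 0 ≤ a') (hg : 0 ≤ g) (hg' : 0 ≤ g')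
    (h : g + g' ≤ L * (b + b' + (n₁ + n₂ + n₃ + n₄))) :
    g * a + g' * a' ≤ β * (a ^ 2 + a' ^ 2 + b ^ 2 + b' ^ 2) +
      6 * L * (n₁ ^ 2 + n₂ ^ 2 + n₃ ^ 2 + n₄ ^ 2) := by
  set n := n₁ + n₂ + n₃ + n₄ with hn
  have h1 : g * a + g' * a' ≤ L * (b + b' + n) * (a + a') :=
    calc g * a + g' * a' ≤ (g + g') * (a + a') := by nlinarith [mul_nonneg hg ha', mul_nonneg hg' ha]
      _ ≤ _ := by gcongr
  have hn2 : n ^ 2 ≤ 4 * (n₁ ^ 2 + n₂ ^ 2 + n₃ ^ 2 + n₄ ^ 2) := by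
    rw [hn]
    nlinarith [sq_nonneg (n₁ - n₂), sq_nonneg (n₁ - n₃), sq_nonneg (n₁ - n₄), sq_nonneg (n₂ - n₃),
      sq_nonneg (n₂ - n₄), sq_nonneg (n₃ - n₄)]
  have h2 : (b + b' + n) * (a + a') ≤ 3 / 2 * (a ^ 2 + a' ^ 2 + b ^ 2 + b' ^ 2) +
      6 * (n₁ ^ 2 + n₂ ^ 2 + n₃ ^ 2 + n₄ ^ 2) := by
    nlinarith [sq_nonneg (b + b' + n - (a + a')), sq_nonneg (a - a'), sq_nonneg (b - b'),
      sq_nonneg (b - n), sq_nonneg (b' - n), sq_nonneg a, sq_nonneg a']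
  have h3 := mul_le_mul_of_nonneg_left h2 hL
  have h4 : 3 / 2 * L * (a ^ 2 + a' ^ 2 + b ^ 2 + b' ^ 2) ≤
      β * (a ^ 2 + a' ^ 2 + b ^ 2 + b' ^ 2) := by gcongr
  linarith

section Regret

variable {d m : ℕ} {R D L G : ℝ} {X Y : Set (E d)} {F : E d × E d → E d × E d} {sx sy : E d → E d}

theorem action_mem (hsx : IsArgminSelection X sx) (hsy : IsArgminSelection Y sy)
    (hcX : Convex ℝ X) (hcY : Convex ℝ Y) (hm : 0 < m) (v : E d × E d) (ζx ζy : Fin m → E d) :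
    action sx sy v ζx ζy ∈ X ×ˢ Y :=
  ⟨sampleMean_mem hsx hcX hm _ _, sampleMean_mem hsy hcY hm _ _⟩

theorem meanPoint_mem (hsx : IsArgminSelection X sx) (hsy : IsArgminSelection Y sy)
    (hcX : Convex ℝ X) (hcY : Convex ℝ Y) (hX : IsCompact X) (hY : IsCompact Y)
    (hR : 0 < R) (v : E d × E d) : meanPoint R sx sy v ∈ X ×ˢ Y :=
  ⟨meanAction_mem hsx hX hcX hR _, meanAction_mem hsy hY hcY hR _⟩

/-- The gradient at the played point depends on the fresh perturbations, so its pairing with the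
deviation is not centred. Replacing it by the gradient at the mean point gives the linear noise, and
the Lipschitz condition makes the replacement error quadratic. -/
theorem inner_playPoint_le (hsx : IsArgminSelection X sx) (hsy : IsArgminSelection Y sy)
    (hcX : Convex ℝ X) (hcY : Convex ℝ Y) (hX : IsCompact X) (hY : IsCompact Y)
    (hR : 0 < R) (hm : 0 < m) (hL : 0 ≤ L)
    (hF : ∀ p ∈ X ×ˢ Y, ∀ q ∈ X ×ˢ Y,
      ‖(F p).1 - (F q).1‖ + ‖(F p).2 - (F q).2‖ ≤ L * ‖p.1 - q.1‖ + L * ‖p.2 - q.2‖)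
    (ζ : Player → Stage → ℕ → Fin m → E d) (t : ℕ) :
    inner ℝ (F (playPoint F sx sy ζ t)).1 (playPoint F sx sy ζ t).1 +
        inner ℝ (F (playPoint F sx sy ζ t)).2 (playPoint F sx sy ζ t).2 ≤
      inner ℝ (F (playPoint F sx sy ζ t)).1 (meanAction R sx (playDir F sx sy ζ t).1) +
        inner ℝ (F (playPoint F sx sy ζ t)).2 (meanAction R sy (playDir F sx sy ζ t).2) +
        linearNoise F sx sy ζ R t + 2 * L * squaredNoise F sx sy ζ R t := by
  have hmem : playPoint F sx sy ζ t ∈ X ×ˢ Y := action_mem hsx hsy hcX hcY hm _ _ _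
  have h := hF _ hmem _ (meanPoint_mem hsx hsy hcX hcY hX hY hR (playDir F sx sy ζ t))
  unfold linearNoise squaredNoise
  set p := playPoint F sx sy ζ t
  set xb := meanAction R sx (playDir F sx sy ζ t).1
  set yb := meanAction R sy (playDir F sx sy ζ t).2
  set f₁ := (F p).1
  set f₂ := (F p).2
  set e₁ := (F (meanPoint R sx sy (playDir F sx sy ζ t))).1
  set e₂ := (F (meanPoint R sx sy (playDir F sx sy ζ t))).2
  change _ ≤ L * ‖p.1 - xb‖ + L * ‖p.2 - yb‖ at h
  have h1 := real_inner_le_norm (f₁ - e₁) (p.1 - xb)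
  have h2 := real_inner_le_norm (f₂ - e₂) (p.2 - yb)
  have i1 : (inner ℝ (f₁ - e₁) (p.1 - xb) : ℝ) =
      inner ℝ f₁ p.1 - inner ℝ f₁ xb - inner ℝ e₁ (p.1 - xb) := by
    rw [inner_sub_left, inner_sub_right]
  have i2 : (inner ℝ (f₂ - e₂) (p.2 - yb) : ℝ) =
      inner ℝ f₂ p.2 - inner ℝ f₂ yb - inner ℝ e₂ (p.2 - yb) := by
    rw [inner_sub_left, inner_sub_right]
  have h3 : ‖f₁ - e₁‖ * ‖p.1 - xb‖ + ‖f₂ - e₂‖ * ‖p.2 - yb‖ ≤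
      2 * L * (‖p.1 - xb‖ ^ 2 + ‖p.2 - yb‖ ^ 2) := by
    calc ‖f₁ - e₁‖ * ‖p.1 - xb‖ + ‖f₂ - e₂‖ * ‖p.2 - yb‖
        ≤ (‖f₁ - e₁‖ + ‖f₂ - e₂‖) * (‖p.1 - xb‖ + ‖p.2 - yb‖) := by
          nlinarith [mul_nonneg (norm_nonneg (f₁ - e₁)) (norm_nonneg (p.2 - yb)),
            mul_nonneg (norm_nonneg (f₂ - e₂)) (norm_nonneg (p.1 - xb))]
      _ ≤ (L * ‖p.1 - xb‖ + L * ‖p.2 - yb‖) * (‖p.1 - xb‖ + ‖p.2 - yb‖) := by gcongr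
      _ = L * (‖p.1 - xb‖ + ‖p.2 - yb‖) ^ 2 := by ring
      _ ≤ L * (2 * (‖p.1 - xb‖ ^ 2 + ‖p.2 - yb‖ ^ 2)) := by
          gcongr
          linarith [sq_nonneg (‖p.1 - xb‖ - ‖p.2 - yb‖)]
      _ = _ := by ring
  have h4 : 0 ≤ 2 * L * (‖(guessPoint F sx sy ζ t).1 - meanAction R sx (gradSum F sx sy ζ t).1‖ ^ 2
      + ‖(guessPoint F sx sy ζ t).2 - meanAction R sy (gradSum F sx sy ζ t).2‖ ^ 2) := by
    positivity
  linarith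

theorem inner_meanAction_playDir_le (hsx : IsArgminSelection X sx) (hsy : IsArgminSelection Y sy)
    (hcX : Convex ℝ X) (hcY : Convex ℝ Y) (hX : IsCompact X) (hY : IsCompact Y) (hd : 0 < d)
    (hR : 0 < R) (hm : 0 < m) (hL : 0 ≤ L) (hDX : Metric.diam X ≤ D) (hDY : Metric.diam Y ≤ D)
    (hD0 : 0 < D) (hRL : 6 * d * D * L ≤ R)
    (hF : ∀ p ∈ X ×ˢ Y, ∀ q ∈ X ×ˢ Y,
      ‖(F p).1 - (F q).1‖ + ‖(F p).2 - (F q).2‖ ≤ L * ‖p.1 - q.1‖ + L * ‖p.2 - q.2‖)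
    (hG : ∀ p ∈ X ×ˢ Y, ‖(F p).1‖ ≤ G ∧ ‖(F p).2‖ ≤ G)
    (ζ : Player → Stage → ℕ → Fin m → E d) (t : ℕ) :
    inner ℝ (F (playPoint F sx sy ζ t)).1 (meanAction R sx (playDir F sx sy ζ t).1) +
        inner ℝ (F (playPoint F sx sy ζ t)).2 (meanAction R sy (playDir F sx sy ζ t).2) ≤
      (meanValue R sx (gradSum F sx sy ζ (t + 1)).1 +
        meanValue R sy (gradSum F sx sy ζ (t + 1)).2) -
      (meanValue R sx (gradSum F sx sy ζ t).1 + meanValue R sy (gradSum F sx sy ζ t).2) +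
        6 * L * squaredNoise F sx sy ζ R t + if t = 0 then 2 * G * D else 0 := by
  have hd' : (0 : ℝ) < d := by exact_mod_cast hd
  have hβ : 3 / 2 * L ≤ R / (4 * d * D) := by
    rw [le_div_iff₀ (by positivity)]
    linarith
  have hp : playPoint F sx sy ζ t ∈ X ×ˢ Y := action_mem hsx hsy hcX hcY hm _ _ _
  have hq : guessPoint F sx sy ζ t ∈ X ×ˢ Y := action_mem hsx hsy hcX hcY hm _ _ _
  have h1 := inner_meanAction_le hsx hX hd hR hDX hD0 (gradSum F sx sy ζ t).1
    (playDir F sx sy ζ t).1 (F (playPoint F sx sy ζ t)).1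
  have h2 := inner_meanAction_le hsy hY hd hR hDY hD0 (gradSum F sx sy ζ t).2
    (playDir F sx sy ζ t).2 (F (playPoint F sx sy ζ t)).2
  have e1 : (playDir F sx sy ζ t).1 - (gradSum F sx sy ζ t).1 = (guessGrad F sx sy ζ t).1 := by
    simp [playDir]
  have e2 : (playDir F sx sy ζ t).2 - (gradSum F sx sy ζ t).2 = (guessGrad F sx sy ζ t).2 := by
    simp [playDir]
  rw [gradSum_succ, Prod.fst_add, Prod.snd_add]
  rw [e1] at h1
  rw [e2] at h2
  have i1 := real_inner_le_norm ((F (playPoint F sx sy ζ t)).1 - (guessGrad F sx sy ζ t).1)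
    (meanAction R sx (playDir F sx sy ζ t).1 -
      meanAction R sx ((gradSum F sx sy ζ t).1 + (F (playPoint F sx sy ζ t)).1))
  have i2 := real_inner_le_norm ((F (playPoint F sx sy ζ t)).2 - (guessGrad F sx sy ζ t).2)
    (meanAction R sy (playDir F sx sy ζ t).2 -
      meanAction R sy ((gradSum F sx sy ζ t).2 + (F (playPoint F sx sy ζ t)).2))
  have hdiam {Z : Set (E d)} {s : E d → E d} (hs : IsArgminSelection Z s) (hZ : IsCompact Z)
      (hcZ : Convex ℝ Z) (hDZ : Metric.diam Z ≤ D) (v w : E d) :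
      ‖meanAction R s v - meanAction R s w‖ ≤ D := by
    rw [← dist_eq_norm]
    exact (Metric.dist_le_diam_of_mem hZ.isBounded (meanAction_mem hs hZ hcZ hR v)
      (meanAction_mem hs hZ hcZ hR w)).trans hDZ
  -- In round 0 the guess is zero rather than a gradient at a nearby point, so the error is bounded
  -- crudely by GD for each player and the negative squares are dropped.
  split_ifs with ht
  · have hM : guessGrad F sx sy ζ t = 0 := by simp [guessGrad, ht]
    have hsq : 0 ≤ 6 * L * squaredNoise F sx sy ζ R t := by unfold squaredNoise; positivity
    have hβ0 : 0 ≤ R / (4 * d * D) := by positivity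
    rw [hM, Prod.fst_zero, sub_zero] at h1 i1
    rw [hM, Prod.snd_zero, sub_zero] at h2 i2
    have j1 := i1.trans (mul_le_mul (hG _ hp).1 (hdiam hsx hX hcX hDX _ _) (norm_nonneg _)
      ((norm_nonneg _).trans (hG _ hp).1))
    have j2 := i2.trans (mul_le_mul (hG _ hp).2 (hdiam hsy hY hcY hDY _ _) (norm_nonneg _)
      ((norm_nonneg _).trans (hG _ hp).2))
    have k (x : E d) := mul_nonneg hβ0 (sq_nonneg ‖x‖)
    linarith [k (meanAction R sx (playDir F sx sy ζ t).1 -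
        meanAction R sx ((gradSum F sx sy ζ t).1 + (F (playPoint F sx sy ζ t)).1)),
      k (meanAction R sy (playDir F sx sy ζ t).2 -
        meanAction R sy ((gradSum F sx sy ζ t).2 + (F (playPoint F sx sy ζ t)).2)),
      k (meanAction R sx (playDir F sx sy ζ t).1 - meanAction R sx (gradSum F sx sy ζ t).1),
      k (meanAction R sy (playDir F sx sy ζ t).2 - meanAction R sy (gradSum F sx sy ζ t).2)]
  · have hM : guessGrad F sx sy ζ t = F (guessPoint F sx sy ζ t) := by simp [guessGrad, ht]
    have hFpq := hF _ hp _ hq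
    rw [hM] at h1 i1 h2 i2
    -- Played and guessed points are compared through their means: the change of means is absorbed
    -- by the negative squares, the two deviations are noise.
    have tri (a b c e : E d) : ‖a - b‖ ≤ ‖c - e‖ + (‖b - e‖ + ‖a - c‖) := by
      have : a - b = (c - e) - (b - e) + (a - c) := by abel
      rw [this]
      linarith [norm_add_le ((c - e) - (b - e)) (a - c), norm_sub_le (c - e) (b - e)]
    have t1 := tri (playPoint F sx sy ζ t).1 (guessPoint F sx sy ζ t).1
      (meanAction R sx (playDir F sx sy ζ t).1) (meanAction R sx (gradSum F sx sy ζ t).1)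
    have t2 := tri (playPoint F sx sy ζ t).2 (guessPoint F sx sy ζ t).2
      (meanAction R sy (playDir F sx sy ζ t).2) (meanAction R sy (gradSum F sx sy ζ t).2)
    have main := mul_add_mul_le_of_add_le hL hβ
      (norm_nonneg (meanAction R sx (playDir F sx sy ζ t).1 -
        meanAction R sx ((gradSum F sx sy ζ t).1 + (F (playPoint F sx sy ζ t)).1)))
      (norm_nonneg (meanAction R sy (playDir F sx sy ζ t).2 -
        meanAction R sy ((gradSum F sx sy ζ t).2 + (F (playPoint F sx sy ζ t)).2)))
      (norm_nonneg ((F (playPoint F sx sy ζ t)).1 - (F (guessPoint F sx sy ζ t)).1))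
      (norm_nonneg ((F (playPoint F sx sy ζ t)).2 - (F (guessPoint F sx sy ζ t)).2))
      (b := ‖meanAction R sx (playDir F sx sy ζ t).1 - meanAction R sx (gradSum F sx sy ζ t).1‖)
      (b' := ‖meanAction R sy (playDir F sx sy ζ t).2 - meanAction R sy (gradSum F sx sy ζ t).2‖)
      (n₁ := ‖(guessPoint F sx sy ζ t).1 - meanAction R sx (gradSum F sx sy ζ t).1‖)
      (n₂ := ‖(guessPoint F sx sy ζ t).2 - meanAction R sy (gradSum F sx sy ζ t).2‖)
      (n₃ := ‖(playPoint F sx sy ζ t).1 - meanAction R sx (playDir F sx sy ζ t).1‖)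
      (n₄ := ‖(playPoint F sx sy ζ t).2 - meanAction R sy (playDir F sx sy ζ t).2‖)
      (by
        rw [← mul_add] at hFpq
        refine hFpq.trans (mul_le_mul_of_nonneg_left ?_ hL)
        linarith)
    unfold squaredNoise
    linarith

theorem sum_inner_playPoint_sub_le (hsx : IsArgminSelection X sx) (hsy : IsArgminSelection Y sy)
    (hcX : Convex ℝ X) (hcY : Convex ℝ Y) (hX : IsCompact X) (hY : IsCompact Y) (hd : 0 < d)
    (hR : 0 < R) (hm : 0 < m) (hL : 0 ≤ L) (hDX : Metric.diam X ≤ D) (hDY : Metric.diam Y ≤ D)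
    (hD0 : 0 < D) (hRL : 6 * d * D * L ≤ R)
    (hF : ∀ p ∈ X ×ˢ Y, ∀ q ∈ X ×ˢ Y,
      ‖(F p).1 - (F q).1‖ + ‖(F p).2 - (F q).2‖ ≤ L * ‖p.1 - q.1‖ + L * ‖p.2 - q.2‖)
    (hG : ∀ p ∈ X ×ˢ Y, ‖(F p).1‖ ≤ G ∧ ‖(F p).2‖ ≤ G)
    (ζ : Player → Stage → ℕ → Fin m → E d) (n : ℕ) {u v : E d} (hu : u ∈ X) (hv : v ∈ Y) :
    ∑ t ∈ Finset.range n,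
        (inner ℝ (F (playPoint F sx sy ζ t)).1 ((playPoint F sx sy ζ t).1 - u) +
          inner ℝ (F (playPoint F sx sy ζ t)).2 ((playPoint F sx sy ζ t).2 - v)) ≤
      2 * R * D + 2 * G * D + ∑ t ∈ Finset.range n, linearNoise F sx sy ζ R t +
        8 * L * ∑ t ∈ Finset.range n, squaredNoise F sx sy ζ R t := by
  have hG0 : 0 ≤ G := (norm_nonneg _).trans (hG (u, v) ⟨hu, hv⟩).1
  have key : ∑ t ∈ Finset.range n,
        (inner ℝ (F (playPoint F sx sy ζ t)).1 (playPoint F sx sy ζ t).1 +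
          inner ℝ (F (playPoint F sx sy ζ t)).2 (playPoint F sx sy ζ t).2) ≤
      (meanValue R sx (gradSum F sx sy ζ n).1 + meanValue R sy (gradSum F sx sy ζ n).2) -
      (meanValue R sx 0 + meanValue R sy 0) +
      ∑ t ∈ Finset.range n, linearNoise F sx sy ζ R t +
        8 * L * ∑ t ∈ Finset.range n, squaredNoise F sx sy ζ R t +
        ∑ t ∈ Finset.range n, if t = 0 then 2 * G * D else 0 := by
    induction n with
    | zero => simp [gradSum]
    | succ n ih =>
      simp only [Finset.sum_range_succ]
      have h1 := inner_playPoint_le hsx hsy hcX hcY hX hY hR hm hL hF ζ n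
      have h2 := inner_meanAction_playDir_le hsx hsy hcX hcY hX hY hd hR hm hL hDX hDY hD0 hRL
        hF hG ζ n
      linarith
  have hif : (∑ t ∈ Finset.range n, if t = 0 then 2 * G * D else 0) ≤ 2 * G * D := by
    rw [Finset.sum_ite_eq' (Finset.range n) 0 fun _ => 2 * G * D]
    split_ifs
    · exact le_rfl
    · positivity
  have hx := meanValue_sub_meanValue_zero_le hsx hX hR hDX (gradSum F sx sy ζ n).1 u hu
  have hy := meanValue_sub_meanValue_zero_le hsy hY hR hDY (gradSum F sx sy ζ n).2 v hv
  have hsum : ∑ t ∈ Finset.range n,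
        (inner ℝ (F (playPoint F sx sy ζ t)).1 ((playPoint F sx sy ζ t).1 - u) +
          inner ℝ (F (playPoint F sx sy ζ t)).2 ((playPoint F sx sy ζ t).2 - v)) =
      ∑ t ∈ Finset.range n,
        (inner ℝ (F (playPoint F sx sy ζ t)).1 (playPoint F sx sy ζ t).1 +
          inner ℝ (F (playPoint F sx sy ζ t)).2 (playPoint F sx sy ζ t).2) -
      (inner ℝ (gradSum F sx sy ζ n).1 u + inner ℝ (gradSum F sx sy ζ n).2 v) := by
    rw [gradSum_eq_sum, Prod.fst_sum, Prod.snd_sum, sum_inner, sum_inner,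
      ← Finset.sum_add_distrib, ← Finset.sum_sub_distrib]
    refine Finset.sum_congr rfl fun t _ => ?_
    rw [inner_sub_right, inner_sub_right]
    ring
  rw [hsum]
  linarith

end Regret

/-! ### Conditioning on the past. -/

/-- Replaces conditional expectation: the joint law of the history (W, Z) and the fresh variable is
a product, so Tonelli applies with a bound K that is uniform in the history. -/
theorem lintegral_mul_le_of_indep {Ω S H : Type*} {m' mΩ : MeasurableSpace Ω}
    [MeasurableSpace S] [MeasurableSpace H] {P : Measure Ω} [IsProbabilityMeasure P]
    (hm' : m' ≤ mΩ) {ξ : Ω → S} (hξ : Measurable ξ)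
    (hind : Indep m' (MeasurableSpace.comap ξ inferInstance) P)
    {W : Ω → ENNReal} {Z : Ω → H} (hW : Measurable[m'] W) (hZ : Measurable[m'] Z)
    {φ : H → S → ENNReal} (hφ : Measurable φ.uncurry) {K : ENNReal}
    (hK : ∀ z, ∫⁻ x, φ z x ∂(P.map ξ) ≤ K) :
    ∫⁻ ω, W ω * φ (Z ω) (ξ ω) ∂P ≤ K * ∫⁻ ω, W ω ∂P := by
  have hWZ : Measurable[m'] fun ω => (W ω, Z ω) := hW.prodMk hZ
  have hWZ' : Measurable fun ω => (W ω, Z ω) := hWZ.mono hm' le_rfl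
  have hI : IndepFun (fun ω => (W ω, Z ω)) ξ P := by
    rw [IndepFun_iff_Indep]
    exact indep_of_indep_of_le_left hind hWZ.comap_le
  have hmap := hI.map_prod_eq_prod_map_map hWZ'.aemeasurable hξ.aemeasurable
  have := Measure.isProbabilityMeasure_map (μ := P) hξ.aemeasurable
  have := Measure.isProbabilityMeasure_map (μ := P) hWZ'.aemeasurable
  have hΨ : Measurable fun p : (ENNReal × H) × S => p.1.1 * φ p.1.2 p.2 :=
    (measurable_fst.comp measurable_fst).mul
      (hφ.comp ((measurable_snd.comp measurable_fst).prodMk measurable_snd))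
  calc ∫⁻ ω, W ω * φ (Z ω) (ξ ω) ∂P
      = ∫⁻ p, p.1.1 * φ p.1.2 p.2 ∂(P.map fun ω => ((W ω, Z ω), ξ ω)) :=
        (lintegral_map hΨ (hWZ'.prodMk hξ)).symm
    _ = ∫⁻ a, ∫⁻ x, a.1 * φ a.2 x ∂(P.map ξ) ∂(P.map fun ω => (W ω, Z ω)) := by
        rw [hmap, lintegral_prod _ hΨ.aemeasurable]
    _ ≤ ∫⁻ a, K * a.1 ∂(P.map fun ω => (W ω, Z ω)) := by
        refine lintegral_mono fun a => ?_
        have : Measurable (φ a.2) := hφ.comp measurable_prodMk_left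
        rw [lintegral_const_mul _ this, mul_comm]
        gcongr
        exact hK _
    _ = K * ∫⁻ ω, W ω ∂P := by
        rw [lintegral_const_mul _ measurable_fst, lintegral_map measurable_fst hWZ']

/-- Markov's inequality for exp S. -/
theorem measure_add_log_le_le {Ω : Type*} [MeasurableSpace Ω] {P : Measure Ω}
    {S : Ω → ℝ} (hS : Measurable S) {a ε : ℝ} (hε : 0 < ε)
    (h : ∫⁻ ω, ENNReal.ofReal (Real.exp (S ω)) ∂P ≤ ENNReal.ofReal (Real.exp a)) :
    P {ω | a + Real.log (1 / ε) ≤ S ω} ≤ ENNReal.ofReal ε := by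
  have h1 := mul_meas_ge_le_lintegral (μ := P)
    (f := fun ω => ENNReal.ofReal (Real.exp (S ω))) (by fun_prop)
    (ENNReal.ofReal (Real.exp (a + Real.log (1 / ε))))
  have hset : {ω | ENNReal.ofReal (Real.exp (a + Real.log (1 / ε))) ≤
      ENNReal.ofReal (Real.exp (S ω))} = {ω | a + Real.log (1 / ε) ≤ S ω} := by
    ext ω
    simp only [Set.mem_ofPred_eq]
    rw [ENNReal.ofReal_le_ofReal_iff (Real.exp_pos _).le, Real.exp_le_exp]
  rw [hset] at h1
  have h2 : ENNReal.ofReal (Real.exp a) =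
      ENNReal.ofReal (Real.exp (a + Real.log (1 / ε))) * ENNReal.ofReal ε := by
    rw [← ENNReal.ofReal_mul (Real.exp_pos _).le, Real.exp_add, Real.exp_log (by positivity)]
    congr 1
    field_simp
  have h3 := (h1.trans h).trans_eq h2
  rwa [ENNReal.mul_le_mul_iff_right (ENNReal.ofReal_pos.2 (Real.exp_pos _)).ne'
    ENNReal.ofReal_ne_top] at h3

/-- The position of the computation of a player in a stage of round `t` in the order of all
computations. -/
def stepIndex : Player → Stage → ℕ → ℕ
  | .xPlayer, .guess, t => 4 * t
  | .yPlayer, .guess, t => 4 * t + 1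
  | .xPlayer, .play, t => 4 * t + 2
  | .yPlayer, .play, t => 4 * t + 3

/-- The σ-algebra generated by the perturbations of the first `k` computations. -/
abbrev past {Ω : Type*} {d m T : ℕ} (σ : Player × Stage × Fin T × Fin m → Ω → E d) (k : ℕ) :
    MeasurableSpace Ω :=
  ⨆ i ∈ {i : Player × Stage × Fin T × Fin m | stepIndex i.1 i.2.1 i.2.2.1 < k},
    MeasurableSpace.comap (σ i) inferInstance

/-- The perturbations as functions of a natural number, with zero perturbations after the last
round. -/
def perturbation {Ω : Type*} {d m T : ℕ} (σ : Player × Stage × Fin T × Fin m → Ω → E d) (ω : Ω)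
    (p : Player) (s : Stage) (t : ℕ) (j : Fin m) : E d :=
  if h : t < T then σ (p, s, ⟨t, h⟩, j) ω else 0

section Past

variable {Ω : Type*} {d m T : ℕ} {σ : Player × Stage × Fin T × Fin m → Ω → E d}

theorem past_mono {k l : ℕ} (h : k ≤ l) : past σ k ≤ past σ l :=
  biSup_mono fun _ hi => lt_of_lt_of_le hi h

theorem past_le [mΩ : MeasurableSpace Ω] (hσ : ∀ i, Measurable (σ i)) (k : ℕ) : past σ k ≤ mΩ :=
  iSup₂_le fun i _ => (hσ i).comap_le

theorem measurable_perturbation_past {p : Player} {s : Stage} {t k : ℕ} (h : stepIndex p s t < k) :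
    Measurable[past σ k] fun ω => perturbation σ ω p s t := by
  refine @measurable_pi_lambda _ _ _ (past σ k) _ _ fun j => ?_
  unfold perturbation
  split_ifs with ht
  · have : MeasurableSpace.comap (σ (p, s, ⟨t, ht⟩, j)) inferInstance ≤ past σ k :=
      le_iSup₂_of_le (p, s, ⟨t, ht⟩, j) h le_rfl
    exact (comap_measurable _).mono this le_rfl
  · exact measurable_const

theorem measurable_perturbation [MeasurableSpace Ω] (hσ : ∀ i, Measurable (σ i)) (p : Player)
    (s : Stage) (t : ℕ) : Measurable fun ω => perturbation σ ω p s t :=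
  (measurable_perturbation_past (Nat.lt_succ_self _)).mono (past_le hσ _) le_rfl

theorem indep_past_perturbation [MeasurableSpace Ω] {P : Measure Ω} (hσ : ∀ i, Measurable (σ i))
    (hind : iIndepFun σ P) {p : Player} {s : Stage} {t k : ℕ} (ht : t < T)
    (hk : k ≤ stepIndex p s t) :
    Indep (past σ k)
      (MeasurableSpace.comap (fun ω => perturbation σ ω p s t) inferInstance) P := by
  have h := indep_iSup_of_disjoint (fun i => (hσ i).comap_le) hind.iIndep
    (S := {i : Player × Stage × Fin T × Fin m | stepIndex i.1 i.2.1 i.2.2.1 < k})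
    (T := {i | stepIndex i.1 i.2.1 i.2.2.1 = stepIndex p s t}) (by
      rw [Set.disjoint_left]
      intro i hi hi'
      simp only [Set.mem_ofPred_eq] at hi hi'
      omega)
  refine indep_of_indep_of_le_right h ?_
  refine Measurable.comap_le ?_
  refine @measurable_pi_lambda _ _ _ (_) _ _ fun j => ?_
  simp only [perturbation, ht, dif_pos]
  refine (comap_measurable (σ (p, s, ⟨t, ht⟩, j))).mono ?_ le_rfl
  exact le_iSup₂_of_le (f := fun i (_ : i ∈ {i : Player × Stage × Fin T × Fin m |
    stepIndex i.1 i.2.1 i.2.2.1 = stepIndex p s t}) => MeasurableSpace.comap (σ i) inferInstance)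
    (p, s, ⟨t, ht⟩, j) rfl le_rfl

theorem map_perturbation [MeasurableSpace Ω] {P : Measure Ω} [IsProbabilityMeasure P] {R : ℝ}
    (hσ : ∀ i, Measurable (σ i)) (hind : iIndepFun σ P)
    (hlaw : ∀ i, P.map (σ i) = uniformBall d R) (p : Player) (s : Stage) {t : ℕ} (ht : t < T) :
    P.map (fun ω => perturbation σ ω p s t) = Measure.pi fun _ : Fin m => uniformBall d R := by
  have hinj : Function.Injective fun j : Fin m => (p, s, (⟨t, ht⟩ : Fin T), j) := by
    intro j j' h
    simpa using h
  have h := (hind.precomp hinj).map_fun_eq_pi_map fun j => (hσ _).aemeasurable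
  simp only [hlaw] at h
  rw [← h]
  congr 1
  ext ω j
  simp [perturbation, ht]

theorem lintegral_mul_perturbation_le [MeasurableSpace Ω] {P : Measure Ω} [IsProbabilityMeasure P]
    {R : ℝ} (hσ : ∀ i, Measurable (σ i)) (hind : iIndepFun σ P)
    (hlaw : ∀ i, P.map (σ i) = uniformBall d R) (p : Player) (s : Stage) {t k : ℕ} (ht : t < T)
    (hk : k ≤ stepIndex p s t) {H : Type*} [MeasurableSpace H] {W : Ω → ENNReal} {Z : Ω → H}
    (hW : Measurable[past σ k] W) (hZ : Measurable[past σ k] Z)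
    {φ : H → (Fin m → E d) → ENNReal} (hφ : Measurable φ.uncurry) {K : ENNReal}
    (hK : ∀ z, ∫⁻ ζ, φ z ζ ∂(Measure.pi fun _ : Fin m => uniformBall d R) ≤ K) :
    ∫⁻ ω, W ω * φ (Z ω) (perturbation σ ω p s t) ∂P ≤ K * ∫⁻ ω, W ω ∂P := by
  refine lintegral_mul_le_of_indep (past_le hσ k) (measurable_perturbation hσ p s t)
    (indep_past_perturbation hσ hind ht hk) hW hZ hφ ?_
  rwa [map_perturbation hσ hind hlaw p s ht]

/-- A fresh perturbation has an absolutely continuous law, so a direction fixed by the past is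
almost surely moved off any given null set. -/
theorem ae_sub_perturbation [MeasurableSpace Ω] {P : Measure Ω} [IsProbabilityMeasure P]
    {R : ℝ} (hσ : ∀ i, Measurable (σ i)) (hind : iIndepFun σ P)
    (hlaw : ∀ i, P.map (σ i) = uniformBall d R) (hR : 0 < R) (p : Player) (s : Stage) {t k : ℕ}
    (ht : t < T) (hk : k ≤ stepIndex p s t) {Z : Ω → E d} (hZ : Measurable[past σ k] Z)
    {q : E d → Prop} (hq : ∀ᵐ w, q w) :
    ∀ᵐ ω ∂P, ∀ j, q (Z ω - perturbation σ ω p s t j) := by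
  have := isProbabilityMeasure_uniformBall (d := d) hR
  rw [ae_all_iff]
  intro j
  -- The exceptional set may fail to be measurable; its measurable hull is still null, and its
  -- indicator is the test function with bound K = 0.
  set B := toMeasurable volume {w | ¬ q w}
  have hB : MeasurableSet B := measurableSet_toMeasurable _ _
  have hB0 : ∀ᵐ w, w ∉ B := by
    rw [ae_iff]
    simp only [not_not, Set.ofPred_mem_eq]
    rw [measure_toMeasurable]
    exact hq
  have hφ : Measurable fun x : E d × (Fin m → E d) => B.indicator (1 : E d → ENNReal)
      (x.1 - x.2 j) := (measurable_one.indicator hB).comp (by fun_prop)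
  have h0 := lintegral_mul_perturbation_le hσ hind hlaw p s ht hk (W := fun _ => 1) (Z := Z)
    measurable_const hZ
    (φ := fun z ζ => B.indicator (1 : E d → ENNReal) (z - ζ j)) hφ (K := 0) fun z => by
      have := (measurePreserving_eval (fun _ : Fin m => uniformBall d R) j).lintegral_comp
        (f := fun w => B.indicator (1 : E d → ENNReal) (z - w))
        ((measurable_one.indicator hB).comp (by fun_prop))
      simp only [Function.eval] at this
      rw [this, nonpos_iff_eq_zero]
      refine lintegral_eq_zero_of_ae_eq_zero ?_
      filter_upwards [ae_uniformBall_sub_left hR hB0 z] with w hw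
      simp [hw]
  simp only [one_mul, zero_mul, nonpos_iff_eq_zero] at h0
  rw [lintegral_eq_zero_iff] at h0
  · filter_upwards [h0] with ω hω
    by_contra hcon
    have : Z ω - perturbation σ ω p s t j ∈ B := subset_toMeasurable _ _ hcon
    simp [this] at hω
  · exact hφ.comp ((hZ.mono (past_le hσ k) le_rfl).prodMk (measurable_perturbation hσ p s t))

end Past

/-! ### Adaptedness of the iterates. -/

section Iterates

variable {Ω : Type*} {d m T : ℕ} {σ : Player × Stage × Fin T × Fin m → Ω → E d}
  {F : E d × E d → E d × E d} {sx sy : E d → E d} {X Y : Set (E d)}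

theorem measurable_action (hsx : IsArgminSelection X sx) (hsy : IsArgminSelection Y sy)
    {mΩ : MeasurableSpace Ω} {v : Ω → E d × E d} {ζx ζy : Ω → Fin m → E d} (hv : Measurable v)
    (hζx : Measurable ζx) (hζy : Measurable ζy) :
    Measurable fun ω => action sx sy (v ω) (ζx ω) (ζy ω) := by
  have hx := (measurable_sampleMean (m := m) hsx).comp (hv.fst.prodMk hζx)
  have hy := (measurable_sampleMean (m := m) hsy).comp (hv.snd.prodMk hζy)
  exact hx.prodMk hy

/-- Measurability of the gradient sum is a hypothesis here and in the next two lemmas so that they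
can serve inside the induction of `measurable_gradSum`. -/
theorem measurable_guessPoint_of_gradSum (hsx : IsArgminSelection X sx)
    (hsy : IsArgminSelection Y sy) {t : ℕ}
    (h : Measurable[past σ (4 * t)] fun ω => gradSum F sx sy (perturbation σ ω) t) :
    Measurable[past σ (4 * t + 2)] fun ω => guessPoint F sx sy (perturbation σ ω) t :=
  measurable_action hsx hsy (h.mono (past_mono (by omega)) le_rfl)
    (measurable_perturbation_past (by simp [stepIndex]))
    (measurable_perturbation_past (by simp [stepIndex]))

theorem measurable_playDir_of_gradSum (hF : Measurable F) (hsx : IsArgminSelection X sx)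
    (hsy : IsArgminSelection Y sy) {t : ℕ}
    (h : Measurable[past σ (4 * t)] fun ω => gradSum F sx sy (perturbation σ ω) t) :
    Measurable[past σ (4 * t + 2)] fun ω => playDir F sx sy (perturbation σ ω) t := by
  refine (h.mono (past_mono (by omega)) le_rfl).add ?_
  unfold guessGrad
  split_ifs
  · exact measurable_const
  · exact hF.comp (measurable_guessPoint_of_gradSum hsx hsy h)

theorem measurable_playPoint_of_gradSum (hF : Measurable F) (hsx : IsArgminSelection X sx)
    (hsy : IsArgminSelection Y sy) {t : ℕ}
    (h : Measurable[past σ (4 * t)] fun ω => gradSum F sx sy (perturbation σ ω) t) :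
    Measurable[past σ (4 * t + 4)] fun ω => playPoint F sx sy (perturbation σ ω) t :=
  measurable_action hsx hsy
    ((measurable_playDir_of_gradSum hF hsx hsy h).mono (past_mono (by omega)) le_rfl)
    (measurable_perturbation_past (by simp [stepIndex]))
    (measurable_perturbation_past (by simp [stepIndex]))

theorem measurable_gradSum (hF : Measurable F) (hsx : IsArgminSelection X sx)
    (hsy : IsArgminSelection Y sy) (t : ℕ) :
    Measurable[past σ (4 * t)] fun ω => gradSum F sx sy (perturbation σ ω) t := by
  induction t with
  | zero => exact measurable_const
  | succ t ih =>
    simp only [gradSum_succ]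
    exact (ih.mono (past_mono (by omega)) le_rfl).add
      (hF.comp (measurable_playPoint_of_gradSum hF hsx hsy ih))

theorem measurable_playDir (hF : Measurable F) (hsx : IsArgminSelection X sx)
    (hsy : IsArgminSelection Y sy) (t : ℕ) :
    Measurable[past σ (4 * t + 2)] fun ω => playDir F sx sy (perturbation σ ω) t :=
  measurable_playDir_of_gradSum hF hsx hsy (measurable_gradSum hF hsx hsy t)

end Iterates

/-! ### Exponential moments of the accumulated noise. -/

/-- `S` is determined by the first `k` computations and has exponential moment at most `exp a`. -/
def HasExpBound {Ω : Type*} [MeasurableSpace Ω] {d m T : ℕ} (P : Measure Ω)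
    (σ : Player × Stage × Fin T × Fin m → Ω → E d) (k : ℕ) (S : Ω → ℝ) (a : ℝ) : Prop :=
  Measurable[past σ k] S ∧
    ∫⁻ ω, ENNReal.ofReal (Real.exp (S ω)) ∂P ≤ ENNReal.ofReal (Real.exp a)

section Concentration

variable {Ω : Type*} [MeasurableSpace Ω] {P : Measure Ω} {d m T : ℕ}
  {σ : Player × Stage × Fin T × Fin m → Ω → E d} {R D G : ℝ}
  {F : E d × E d → E d × E d} {sx sy : E d → E d} {X Y : Set (E d)}

theorem HasExpBound.mono {k l : ℕ} {S : Ω → ℝ} {a : ℝ} (h : HasExpBound P σ k S a) (hkl : k ≤ l) :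
    HasExpBound P σ l S a :=
  ⟨h.1.mono (past_mono hkl) le_rfl, h.2⟩

theorem HasExpBound.congr {k : ℕ} {S S' : Ω → ℝ} {a a' : ℝ} (h : HasExpBound P σ k S a)
    (hS : ∀ ω, S' ω = S ω) (ha : a' = a) : HasExpBound P σ k S' a' := by
  rw [funext hS, ha]
  exact h

variable [IsProbabilityMeasure P]

/-- The supermartingale step: a fresh term whose exponential moment is bounded uniformly in the past
adds its exponent. -/
theorem HasExpBound.add_perturbation {t k : ℕ} {S : Ω → ℝ} {a : ℝ} (h : HasExpBound P σ k S a)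
    (hσ : ∀ i, Measurable (σ i)) (hind : iIndepFun σ P)
    (hlaw : ∀ i, P.map (σ i) = uniformBall d R) (p : Player) (s : Stage) (ht : t < T)
    (hk : k = stepIndex p s t) {H : Type*} [MeasurableSpace H] {Z : Ω → H}
    (hZ : Measurable[past σ k] Z) {ψ : H × (Fin m → E d) → ℝ} (hψ : Measurable ψ) {κ : ℝ}
    (hκ : ∀ z, ∫⁻ ζ, ENNReal.ofReal (Real.exp (ψ (z, ζ)))
      ∂(Measure.pi fun _ : Fin m => uniformBall d R) ≤ ENNReal.ofReal (Real.exp κ)) :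
    HasExpBound P σ (k + 1) (fun ω => S ω + ψ (Z ω, perturbation σ ω p s t)) (a + κ) := by
  have hexp : Measurable fun r : ℝ => ENNReal.ofReal (Real.exp r) := by fun_prop
  refine ⟨(h.1.mono (past_mono (Nat.le_succ k)) le_rfl).add (hψ.comp
    ((hZ.mono (past_mono (Nat.le_succ k)) le_rfl).prodMk
      (measurable_perturbation_past (by omega)))), ?_⟩
  simp_rw [Real.exp_add, ENNReal.ofReal_mul (Real.exp_pos _).le]
  refine (lintegral_mul_perturbation_le hσ hind hlaw p s ht hk.le (hexp.comp h.1) hZ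
    (φ := fun z ζ => ENNReal.ofReal (Real.exp (ψ (z, ζ)))) (hexp.comp hψ) hκ).trans ?_
  rw [mul_comm]
  exact mul_le_mul_left h.2 _

theorem measurable_sampleMean_sub {s : E d → E d} {Z : Set (E d)} (hs : IsArgminSelection Z s)
    (hZ : IsCompact Z) (hd : 0 < d) (hR : 0 < R) {H : Type*} [MeasurableSpace H] {g : H → E d}
    (hg : Measurable g) :
    Measurable fun a : H × (Fin m → E d) => sampleMean s (g a.1) a.2 - meanAction R s (g a.1) := by
  have hg' : Measurable fun a : H × (Fin m → E d) => g a.1 := hg.comp measurable_fst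
  have h1 := (measurable_sampleMean (m := m) hs).comp (hg'.prodMk measurable_snd)
  have h2 := (continuous_meanAction hs hZ hd hR).measurable.comp hg'
  exact h1.sub h2

/-- The coefficient of each deviation is a gradient at the mean point, known before the play
perturbations and bounded by G. A round has two such deviations, whence 4m in place of 8m. -/
theorem hasExpBound_linearNoise (hσ : ∀ i, Measurable (σ i)) (hind : iIndepFun σ P)
    (hlaw : ∀ i, P.map (σ i) = uniformBall d R) (hF : Measurable F)
    (hsx : IsArgminSelection X sx) (hsy : IsArgminSelection Y sy)
    (hcX : Convex ℝ X) (hcY : Convex ℝ Y) (hX : IsCompact X) (hY : IsCompact Y) (hd : 0 < d)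
    (hR : 0 < R) (hm : 0 < m) (hDX : Metric.diam X ≤ D) (hDY : Metric.diam Y ≤ D)
    (hG : ∀ p ∈ X ×ˢ Y, ‖(F p).1‖ ≤ G ∧ ‖(F p).2‖ ≤ G) (l : ℝ) {n : ℕ} (hn : n ≤ T) :
    HasExpBound P σ (4 * n)
      (fun ω => ∑ t ∈ Finset.range n, l * linearNoise F sx sy (perturbation σ ω) R t)
      (n * (D ^ 2 / (4 * m) * (l ^ 2 * G ^ 2))) := by
  have hFm : Measurable fun v => F (meanPoint R sx sy v) := hF.comp
    (((continuous_meanAction hsx hX hd hR).measurable.comp measurable_fst).prodMk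
      ((continuous_meanAction hsy hY hd hR).measurable.comp measurable_snd))
  have hψ {s : E d → E d} {Z : Set (E d)} (hs : IsArgminSelection Z s) (hZ : IsCompact Z)
      {f g : E d × E d → E d} (hf : Measurable f) (hg : Measurable g) :
      Measurable fun a : (E d × E d) × (Fin m → E d) =>
        l * (inner ℝ (f a.1) (sampleMean s (g a.1) a.2 - meanAction R s (g a.1)) : ℝ) :=
    ((hf.comp measurable_fst).inner (measurable_sampleMean_sub hs hZ hd hR hg)).const_mul l
  have hκ {s : E d → E d} {Z : Set (E d)} (hs : IsArgminSelection Z s) (hZ : IsCompact Z)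
      (hDZ : Metric.diam Z ≤ D) (v θ : E d) (hθ : ‖θ‖ ≤ G) :
      ∫⁻ ζ, ENNReal.ofReal (Real.exp (l * inner ℝ θ (sampleMean s v ζ - meanAction R s v)))
        ∂(Measure.pi fun _ : Fin m => uniformBall d R) ≤
        ENNReal.ofReal (Real.exp (D ^ 2 / (8 * m) * (l ^ 2 * G ^ 2))) := by
    simp_rw [← real_inner_smul_left]
    refine (lintegral_exp_inner_sampleMean_le hs hZ hR hDZ hm v (l • θ)).trans ?_
    rw [norm_smul, mul_pow, Real.norm_eq_abs, sq_abs]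
    gcongr
  induction n with
  | zero => simp [HasExpBound, measurable_const]
  | succ n ih =>
    have hdir := measurable_playDir (σ := σ) hF hsx hsy n
    have hκx (v : E d × E d) := hκ hsx hX hDX v.1 _
      (hG _ (meanPoint_mem hsx hsy hcX hcY hX hY hR v)).1
    have hκy (v : E d × E d) := hκ hsy hY hDY v.2 _
      (hG _ (meanPoint_mem hsx hsy hcX hcY hX hY hR v)).2
    have h1 := ((ih (by omega)).mono (l := 4 * n + 2) (by omega)).add_perturbation hσ hind hlaw
      .xPlayer .play (t := n) (by omega) rfl hdir
      (ψ := fun a => l * inner ℝ (F (meanPoint R sx sy a.1)).1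
        (sampleMean sx a.1.1 a.2 - meanAction R sx a.1.1))
      (hψ hsx hX hFm.fst measurable_fst) hκx
    have h2 := h1.add_perturbation hσ hind hlaw
      .yPlayer .play (t := n) (by omega) rfl (hdir.mono (past_mono (by omega)) le_rfl)
      (ψ := fun a => l * inner ℝ (F (meanPoint R sx sy a.1)).2
        (sampleMean sy a.1.2 a.2 - meanAction R sy a.1.2))
      (hψ hsy hY hFm.snd measurable_snd) hκy
    refine h2.congr (fun ω => ?_) ?_
    · rw [Finset.sum_range_succ, add_assoc, ← mul_add]
      rfl
    · push_cast
      have : (m : ℝ) ≠ 0 := by positivity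
      field_simp
      ring

/-- Four computations per round, each with moment at most 2^(d/2). -/
theorem hasExpBound_squaredNoise (hσ : ∀ i, Measurable (σ i)) (hind : iIndepFun σ P)
    (hlaw : ∀ i, P.map (σ i) = uniformBall d R) (hF : Measurable F)
    (hsx : IsArgminSelection X sx) (hsy : IsArgminSelection Y sy)
    (hX : IsCompact X) (hY : IsCompact Y) (hd : 0 < d)
    (hR : 0 < R) (hm : 0 < m) (hDX : Metric.diam X ≤ D) (hDY : Metric.diam Y ≤ D) (hD0 : 0 < D)
    {n : ℕ} (hn : n ≤ T) :
    HasExpBound P σ (4 * n)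
      (fun ω => ∑ t ∈ Finset.range n, m / D ^ 2 * squaredNoise F sx sy (perturbation σ ω) R t)
      (n * (2 * d * Real.log 2)) := by
  have hψ {s : E d → E d} {Z : Set (E d)} (hs : IsArgminSelection Z s) (hZ : IsCompact Z)
      {g : E d × E d → E d} (hg : Measurable g) :
      Measurable fun a : (E d × E d) × (Fin m → E d) =>
        m / D ^ 2 * ‖sampleMean s (g a.1) a.2 - meanAction R s (g a.1)‖ ^ 2 :=
    ((measurable_sampleMean_sub hs hZ hd hR hg).norm.pow_const 2).const_mul _
  have hκ {s : E d → E d} {Z : Set (E d)} (hs : IsArgminSelection Z s) (hZ : IsCompact Z)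
      (hDZ : Metric.diam Z ≤ D) (v : E d) :
      ∫⁻ ζ, ENNReal.ofReal
          (Real.exp (m / D ^ 2 * ‖sampleMean s v ζ - meanAction R s v‖ ^ 2))
        ∂(Measure.pi fun _ : Fin m => uniformBall d R) ≤
        ENNReal.ofReal (Real.exp (d / 2 * Real.log 2)) := by
    rw [mul_comm (d / 2 : ℝ), ← Real.rpow_def_of_pos two_pos]
    exact lintegral_exp_sq_norm_sampleMean_le hs hZ hR hDZ hD0 hm v
  induction n with
  | zero => simp [HasExpBound, measurable_const]
  | succ n ih =>
    have hsum := measurable_gradSum (σ := σ) hF hsx hsy n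
    have hdir := measurable_playDir (σ := σ) hF hsx hsy n
    have h2 := ((ih (by omega)).add_perturbation hσ hind hlaw .xPlayer .guess (t := n) (by omega)
      rfl hsum (hψ hsx hX measurable_fst) fun v => hκ hsx hX hDX v.1).add_perturbation hσ hind hlaw
      .yPlayer .guess (t := n) (by omega) rfl (hsum.mono (past_mono (by omega)) le_rfl)
      (hψ hsy hY measurable_snd) fun v => hκ hsy hY hDY v.2
    have h4 := (h2.add_perturbation hσ hind hlaw .xPlayer .play (t := n) (by omega)
      rfl hdir (hψ hsx hX measurable_fst) fun v => hκ hsx hX hDX v.1).add_perturbation hσ hind hlaw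
      .yPlayer .play (t := n) (by omega) rfl (hdir.mono (past_mono (by omega)) le_rfl)
      (hψ hsy hY measurable_snd) fun v => hκ hsy hY hDY v.2
    refine h4.congr (fun ω => ?_) ?_
    · rw [Finset.sum_range_succ, squaredNoise]
      simp only [guessPoint, playPoint, action, mul_add, add_assoc]
    · push_cast
      ring

end Concentration

/-! ### Every run agrees almost surely with the selected iterates. -/

section Identification

variable {d m T : ℕ} {X Y : Set (E d)} {sx sy : E d → E d} {gx gy : E d → E d → E d}
  {F : E d × E d → E d × E d}

theorem IsPerturbedMax.isPerturbedMin_neg {v z : E d} {s : Fin m → E d}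
    (h : IsPerturbedMax Y v s z) : IsPerturbedMin Y (-v) s z := by
  obtain ⟨w, hw, hz⟩ := h
  refine ⟨w, fun j => ⟨(hw j).1, fun u hu => ?_⟩, hz⟩
  have h1 : (inner ℝ (v + s j) u : ℝ) ≤ inner ℝ (v + s j) (w j) := (hw j).2 hu
  have h2 (a : E d) : (inner ℝ (-v - s j) a : ℝ) = -inner ℝ (v + s j) a := by
    rw [← inner_neg_left, neg_add, sub_eq_add_neg]
  simp only [Set.mem_ofPred_eq, h2]
  linarith

theorem IsPerturbedMin.eq_sampleMean {s : E d → E d} {v z : E d} {ζ : Fin m → E d}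
    (h : IsPerturbedMin X v ζ z)
    (huniq : ∀ j, ∀ u ∈ X, IsMinOn (fun u => inner ℝ (v - ζ j) u) X u → u = s (v - ζ j)) :
    z = sampleMean s v ζ := by
  obtain ⟨w, hw, rfl⟩ := h
  rw [sampleMean]
  congr 1
  exact Finset.sum_congr rfl fun j _ => huniq j _ (hw j).1 (hw j).2

/-- Strong induction on the round: equal past actions give equal gradient sums, and uniqueness of
the minimizers forces equal guesses and then equal plays. The maximizing player enters with the
opposite direction. -/
theorem eq_playPoint_of_isRun (hsx : IsArgminSelection X sx) (hsy : IsArgminSelection Y sy)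
    (hcX : Convex ℝ X) (hcY : Convex ℝ Y) (hm : 0 < m)
    (hF : ∀ p ∈ X ×ˢ Y, F p = (gx p.1 p.2, -gy p.1 p.2))
    {ζ : Player → Stage → ℕ → Fin m → E d} {x y : Fin T → E d}
    (hrun : IsRun X Y gx gy (fun p s t j => ζ p s t j) x y)
    (hx : ∀ t < T, ∀ j, ∀ u ∈ X, IsMinOn (fun u => inner ℝ
      ((gradSum F sx sy ζ t).1 - ζ .xPlayer .guess t j) u) X u →
        u = sx ((gradSum F sx sy ζ t).1 - ζ .xPlayer .guess t j))
    (hy : ∀ t < T, ∀ j, ∀ u ∈ Y, IsMinOn (fun u => inner ℝ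
      ((gradSum F sx sy ζ t).2 - ζ .yPlayer .guess t j) u) Y u →
        u = sy ((gradSum F sx sy ζ t).2 - ζ .yPlayer .guess t j))
    (hx' : ∀ t < T, ∀ j, ∀ u ∈ X, IsMinOn (fun u => inner ℝ
      ((playDir F sx sy ζ t).1 - ζ .xPlayer .play t j) u) X u →
        u = sx ((playDir F sx sy ζ t).1 - ζ .xPlayer .play t j))
    (hy' : ∀ t < T, ∀ j, ∀ u ∈ Y, IsMinOn (fun u => inner ℝ
      ((playDir F sx sy ζ t).2 - ζ .yPlayer .play t j) u) Y u →
        u = sy ((playDir F sx sy ζ t).2 - ζ .yPlayer .play t j)) (t : Fin T) :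
    (x t, y t) = playPoint F sx sy ζ t := by
  obtain ⟨t, ht⟩ := t
  induction t using Nat.strong_induction_on with
  | _ t ih =>
  have hmem (i : ℕ) : playPoint F sx sy ζ i ∈ X ×ˢ Y := action_mem hsx hsy hcX hcY hm _ _ _
  rcases Nat.eq_zero_or_pos t with rfl | hpos
  · obtain ⟨h1, h2⟩ := hrun.first ⟨0, ht⟩ rfl
    have hdir : playDir F sx sy ζ 0 = 0 := by simp [playDir, guessGrad, gradSum]
    have k1 := h1.eq_sampleMean (s := sx) (by simpa [hdir] using hx' 0 ht)
    have k2 := h2.isPerturbedMin_neg.eq_sampleMean (s := sy) (by simpa [hdir] using hy' 0 ht)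
    rw [k1, k2, neg_zero, playPoint, hdir]
    rfl
  · have hsum : gradSum F sx sy ζ t =
        (∑ i ∈ Finset.Iio (⟨t, ht⟩ : Fin T), gx (x i) (y i),
          -∑ i ∈ Finset.Iio (⟨t, ht⟩ : Fin T), gy (x i) (y i)) := by
      have h1 : ∑ i ∈ Finset.Iio (⟨t, ht⟩ : Fin T), F (playPoint F sx sy ζ i) =
          ∑ i ∈ Finset.range t, F (playPoint F sx sy ζ i) := by
        rw [← Nat.Iio_eq_range, ← Fin.map_valEmbedding_Iio ⟨t, ht⟩, Finset.sum_map]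
        rfl
      rw [gradSum_eq_sum, ← h1, ← Finset.sum_neg_distrib, prod_mk_sum]
      refine Finset.sum_congr rfl fun i hi => ?_
      rw [hF _ (hmem i), ← ih i (Fin.lt_def.1 (Finset.mem_Iio.1 hi)) i.2]
    obtain ⟨x', y', h1, h2, h3, h4⟩ := hrun.later ⟨t, ht⟩ hpos
    have e1 : ∑ i ∈ Finset.Iio (⟨t, ht⟩ : Fin T), gx (x i) (y i) = (gradSum F sx sy ζ t).1 := by
      rw [hsum]
    have e2 : -∑ i ∈ Finset.Iio (⟨t, ht⟩ : Fin T), gy (x i) (y i) = (gradSum F sx sy ζ t).2 := by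
      rw [hsum]
    have h2' := h2.isPerturbedMin_neg
    have h4' := h4.isPerturbedMin_neg
    rw [neg_add] at h4'
    rw [e1] at h1 h3
    rw [e2] at h2' h4'
    have k1 := h1.eq_sampleMean (hx t ht)
    have k2 := h2'.eq_sampleMean (hy t ht)
    have hg : (x', y') = guessPoint F sx sy ζ t := by rw [k1, k2]; rfl
    have hgm : guessPoint F sx sy ζ t ∈ X ×ˢ Y := action_mem hsx hsy hcX hcY hm _ _ _
    have hgrad : guessGrad F sx sy ζ t = (gx x' y', -gy x' y') := by
      rw [guessGrad, if_neg hpos.ne', hF _ hgm, ← hg]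
    have d1 : (gradSum F sx sy ζ t).1 + gx x' y' = (playDir F sx sy ζ t).1 := by
      rw [playDir, hgrad, Prod.fst_add]
    have d2 : (gradSum F sx sy ζ t).2 + -gy x' y' = (playDir F sx sy ζ t).2 := by
      rw [playDir, hgrad, Prod.snd_add]
    rw [d1] at h3
    rw [d2] at h4'
    rw [h3.eq_sampleMean (hx' t ht), h4'.eq_sampleMean (hy' t ht)]
    rfl

theorem ae_eq_playPoint {Ω : Type*} [MeasurableSpace Ω] {P : Measure Ω} [IsProbabilityMeasure P]
    {σ : Player × Stage × Fin T × Fin m → Ω → E d} {R : ℝ} (hσ : ∀ i, Measurable (σ i))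
    (hind : iIndepFun σ P) (hlaw : ∀ i, P.map (σ i) = uniformBall d R) (hR : 0 < R)
    (hFm : Measurable F) (hsx : IsArgminSelection X sx) (hsy : IsArgminSelection Y sy)
    (hcX : Convex ℝ X) (hcY : Convex ℝ Y) (hm : 0 < m)
    (hF : ∀ p ∈ X ×ˢ Y, F p = (gx p.1 p.2, -gy p.1 p.2)) :
    ∀ᵐ ω ∂P, ∀ x y : Fin T → E d, IsRun X Y gx gy (fun p s t j => σ (p, s, t, j) ω) x y →
      ∀ t, (x t, y t) = playPoint F sx sy (perturbation σ ω) t := by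
  have hsum (t : ℕ) := measurable_gradSum (σ := σ) hFm hsx hsy t
  have hdir (t : ℕ) := measurable_playDir (σ := σ) hFm hsx hsy t
  have h1 := ae_all_iff.2 fun t : Fin T => ae_sub_perturbation hσ hind hlaw hR .xPlayer .guess
    (t := t) t.2 (k := 4 * t) le_rfl (hsum t).fst hsx.ae_eq
  have h2 := ae_all_iff.2 fun t : Fin T => ae_sub_perturbation hσ hind hlaw hR .yPlayer .guess
    (t := t) t.2 (k := 4 * t) (Nat.le_succ _) (hsum t).snd hsy.ae_eq
  have h3 := ae_all_iff.2 fun t : Fin T => ae_sub_perturbation hσ hind hlaw hR .xPlayer .play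
    (t := t) t.2 (k := 4 * t + 2) le_rfl (hdir t).fst hsx.ae_eq
  have h4 := ae_all_iff.2 fun t : Fin T => ae_sub_perturbation hσ hind hlaw hR .yPlayer .play
    (t := t) t.2 (k := 4 * t + 2) (Nat.le_succ _) (hdir t).snd hsy.ae_eq
  filter_upwards [h1, h2, h3, h4] with ω w1 w2 w3 w4 x y hrun t
  have hrun' : IsRun X Y gx gy (fun p s (t : Fin T) j => perturbation σ ω p s t j) x y := by
    convert hrun with p s t j
    simp [perturbation]
  exact eq_playPoint_of_isRun hsx hsy hcX hcY hm hF hrun' (fun t ht => w1 ⟨t, ht⟩)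
    (fun t ht => w2 ⟨t, ht⟩) (fun t ht => w3 ⟨t, ht⟩) (fun t ht => w4 ⟨t, ht⟩) t

end Identification

/-! ### High-probability noise bounds and passage to the duality gap. -/

/-- Restriction to the segment from x to u reduces this to the slope inequality on [0, 1], where a
derivative within X suffices. -/
theorem inner_sub_le_of_hasGradientWithinAt {d : ℕ} {X : Set (E d)} {f : E d → ℝ} {g x u : E d}
    (hf : ConvexOn ℝ X f) (hx : x ∈ X) (hu : u ∈ X) (hg : HasGradientWithinAt f g X x) :
    inner ℝ g (u - x) ≤ f u - f x := by
  have hmaps : Set.MapsTo (AffineMap.lineMap x u : ℝ → E d) (Set.Icc 0 1) X := fun t ht =>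
    hf.1.lineMap_mem hx hu ht
  have hconv : ConvexOn ℝ (Set.Icc (0 : ℝ) 1) (f ∘ (AffineMap.lineMap x u : ℝ →ᵃ[ℝ] E d)) :=
    (hf.comp_affineMap (AffineMap.lineMap x u)).subset hmaps (convex_Icc 0 1)
  have hg' : HasFDerivWithinAt f (InnerProductSpace.toDual ℝ (E d) g) X
      ((AffineMap.lineMap x u : ℝ → E d) 0) := by
    rw [AffineMap.lineMap_apply_zero]
    exact hg.hasFDerivWithinAt
  have hderiv : HasDerivWithinAt (f ∘ (AffineMap.lineMap x u : ℝ → E d)) (inner ℝ g (u - x))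
      (Set.Icc 0 1) 0 := by
    have := hg'.comp_hasDerivWithinAt (0 : ℝ) AffineMap.hasDerivWithinAt_lineMap hmaps
    simpa using this
  have := hconv.le_slope_of_hasDerivWithinAt (x := 0) (y := 1) (by simp) (by simp) one_pos hderiv
  simpa [slope_def_field] using this

theorem exists_measurableSet_noise_le {Ω : Type*} [MeasurableSpace Ω] {P : Measure Ω}
    [IsProbabilityMeasure P] {d T : ℕ} {σ : Player × Stage × Fin T × Fin T → Ω → E d}
    {R D G δ : ℝ} {F : E d × E d → E d × E d} {sx sy : E d → E d} {X Y : Set (E d)}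
    (hσ : ∀ i, Measurable (σ i)) (hind : iIndepFun σ P)
    (hlaw : ∀ i, P.map (σ i) = uniformBall d R) (hF : Measurable F)
    (hsx : IsArgminSelection X sx) (hsy : IsArgminSelection Y sy)
    (hcX : Convex ℝ X) (hcY : Convex ℝ Y) (hX : IsCompact X) (hY : IsCompact Y) (hd : 0 < d)
    (hR : 0 < R) (hT : 0 < T) (hDX : Metric.diam X ≤ D) (hDY : Metric.diam Y ≤ D) (hD0 : 0 < D)
    (hG : ∀ p ∈ X ×ˢ Y, ‖(F p).1‖ ≤ G ∧ ‖(F p).2‖ ≤ G) (hδ : 0 < δ) (hδ1 : δ < 1) :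
    ∃ A : Set Ω, MeasurableSet A ∧ ENNReal.ofReal (1 - δ) ≤ P A ∧ ∀ ω ∈ A,
      ∑ t ∈ Finset.range T, linearNoise F sx sy (perturbation σ ω) R t ≤
        5 / 4 * (G * D * Real.sqrt (Real.log (8 / δ))) ∧
      ∑ t ∈ Finset.range T, squaredNoise F sx sy (perturbation σ ω) R t ≤
        D ^ 2 * (2 * d + Real.log (16 * T / δ)) := by
  have hT' : (0 : ℝ) < T := by exact_mod_cast hT
  have hT1 : (1 : ℝ) ≤ T := by exact_mod_cast hT
  set w := Real.sqrt (Real.log (8 / δ)) with hw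
  have hlog8 : 0 < Real.log (8 / δ) := Real.log_pos (by rw [lt_div_iff₀ hδ]; linarith)
  have hw0 : 0 < w := Real.sqrt_pos.2 hlog8
  have hw2 : w ^ 2 = Real.log (8 / δ) := Real.sq_sqrt hlog8.le
  have hG0 : 0 ≤ G := (norm_nonneg _).trans (hG (sx 0, sy 0) ⟨hsx.mem 0, hsy.mem 0⟩).1
  -- At the scale w/(GD) the moment exponent is w²/4 and the tail term at most w², which gives the
  -- factor 5/4. For G = 0 the scale is 0 and carries no information; the noise then vanishes
  -- identically.
  obtain ⟨hm1, hi1⟩ := hasExpBound_linearNoise hσ hind hlaw hF hsx hsy hcX hcY hX hY hd hR hT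
    hDX hDY hG (w / (G * D)) le_rfl
  obtain ⟨hm2, hi2⟩ := hasExpBound_squaredNoise hσ hind hlaw hF hsx hsy hX hY hd hR hT
    hDX hDY hD0 le_rfl
  have hm1' := hm1.mono (past_le hσ _) le_rfl
  have hm2' := hm2.mono (past_le hσ _) le_rfl
  have hP1 := measure_add_log_le_le hm1' (half_pos hδ) hi1
  have hP2 := measure_add_log_le_le hm2' (half_pos hδ) hi2
  set B₁ := {ω | T * (D ^ 2 / (4 * T) * ((w / (G * D)) ^ 2 * G ^ 2)) + Real.log (1 / (δ / 2)) ≤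
    ∑ t ∈ Finset.range T, w / (G * D) * linearNoise F sx sy (perturbation σ ω) R t} with hB₁
  set B₂ := {ω | T * (2 * d * Real.log 2) + Real.log (1 / (δ / 2)) ≤
    ∑ t ∈ Finset.range T, T / D ^ 2 * squaredNoise F sx sy (perturbation σ ω) R t} with hB₂
  have hB₁m : MeasurableSet B₁ := measurableSet_le measurable_const hm1'
  have hB₂m : MeasurableSet B₂ := measurableSet_le measurable_const hm2'
  refine ⟨(B₁ ∪ B₂)ᶜ, (hB₁m.union hB₂m).compl, ?_, ?_⟩
  · rw [prob_compl_eq_one_sub (hB₁m.union hB₂m), ENNReal.ofReal_sub _ hδ.le, ENNReal.ofReal_one]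
    refine tsub_le_tsub_left ((measure_union_le _ _).trans ((add_le_add hP1 hP2).trans_eq ?_)) _
    rw [← ENNReal.ofReal_add (half_pos hδ).le (half_pos hδ).le, add_halves]
  · intro ω hω
    rw [Set.compl_union] at hω
    obtain ⟨h1, h2⟩ := hω
    simp only [hB₁, hB₂, Set.mem_compl_iff, Set.mem_ofPred_eq, not_le, ← Finset.mul_sum] at h1 h2
    have hlog2 : Real.log (1 / (δ / 2)) ≤ w ^ 2 := by
      rw [hw2]
      refine Real.log_le_log (by positivity) ?_
      rw [one_div_div]
      gcongr
      norm_num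
    constructor
    · rcases hG0.eq_or_lt with hG00 | hGpos
      · have : ∑ t ∈ Finset.range T, linearNoise F sx sy (perturbation σ ω) R t = 0 := by
          refine Finset.sum_eq_zero fun t _ => ?_
          obtain ⟨k1, k2⟩ := hG _ (meanPoint_mem hsx hsy hcX hcY hX hY hR
            (playDir F sx sy (perturbation σ ω) t))
          rw [← hG00, norm_le_zero_iff] at k1 k2
          rw [linearNoise, k1, k2, inner_zero_left, inner_zero_left, add_zero]
        rw [this]
        positivity
      · have hGD : 0 < G * D := by positivity
        have e1 : T * (D ^ 2 / (4 * T) * ((w / (G * D)) ^ 2 * G ^ 2)) = w ^ 2 / 4 := by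
          field_simp
        rw [e1] at h1
        have h3 := (h1.trans_le (add_le_add le_rfl hlog2)).le
        rw [div_mul_eq_mul_div, div_le_iff₀ hGD] at h3
        refine le_of_mul_le_mul_left (h3.trans_eq ?_) hw0
        ring
    · have hD2 : 0 < D ^ 2 := by positivity
      rw [div_mul_eq_mul_div, div_lt_iff₀ hD2] at h2
      have hlogT : Real.log (1 / (δ / 2)) ≤ Real.log (16 * T / δ) := by
        refine Real.log_le_log (by positivity) ?_
        rw [one_div_div]
        gcongr
        linarith
      have hlogT0 : 0 ≤ Real.log (16 * T / δ) := by
        refine Real.log_nonneg ?_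
        rw [le_div_iff₀ hδ]
        linarith
      have hl2 : Real.log 2 ≤ 1 := by linarith [Real.log_two_lt_d9]
      refine le_of_mul_le_mul_left (h2.le.trans ?_) hT'
      calc (T * (2 * d * Real.log 2) + Real.log (1 / (δ / 2))) * D ^ 2
          ≤ (T * (2 * d * 1) + T * Real.log (16 * T / δ)) * D ^ 2 := by
            gcongr
            exact hlogT.trans (le_mul_of_one_le_left hlogT0 hT1)
        _ = _ := by ring

/-- The gradients are arbitrary off X × Y, so they are cut off there; on this closed set they are
Lipschitz. -/
theorem measurable_indicator_of_lipschitz {d : ℕ} {X Y : Set (E d)} (hX : IsCompact X)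
    (hY : IsCompact Y) {gx gy : E d → E d → E d} {L : ℝ}
    (hL : ∀ x ∈ X, ∀ y ∈ Y, ∀ x' ∈ X, ∀ y' ∈ Y,
      ‖gx x y - gx x' y'‖ + ‖gy x y - gy x' y'‖ ≤ L * ‖x - x'‖ + L * ‖y - y'‖) :
    Measurable ((X ×ˢ Y).indicator fun p : E d × E d => (gx p.1 p.2, -gy p.1 p.2)) := by
  classical
  have hlip : LipschitzOnWith (2 * L).toNNReal
      (fun p : E d × E d => (gx p.1 p.2, -gy p.1 p.2)) (X ×ˢ Y) := by
    refine LipschitzOnWith.of_dist_le_mul fun p hp q hq => ?_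
    have h := hL p.1 hp.1 p.2 hp.2 q.1 hq.1 q.2 hq.2
    have h1 : ‖p.1 - q.1‖ ≤ dist p q := by rw [← dist_eq_norm]; exact le_max_left _ _
    have h2 : ‖p.2 - q.2‖ ≤ dist p q := by rw [← dist_eq_norm]; exact le_max_right _ _
    have h3 : dist (gx p.1 p.2, -gy p.1 p.2) (gx q.1 q.2, -gy q.1 q.2) ≤
        ‖gx p.1 p.2 - gx q.1 q.2‖ + ‖gy p.1 p.2 - gy q.1 q.2‖ := by
      rw [Prod.dist_eq, dist_neg_neg, dist_eq_norm, dist_eq_norm]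
      exact max_le (le_add_of_nonneg_right (norm_nonneg _)) (le_add_of_nonneg_left (norm_nonneg _))
    have h4 : L ≤ max L 0 := le_max_left _ _
    have h5 : ((2 * L).toNNReal : ℝ) = 2 * max L 0 := by
      rw [Real.coe_toNNReal', mul_max_of_nonneg _ _ zero_le_two, mul_zero]
    rw [h5]
    have h6 : 0 ≤ max L 0 := le_max_right _ _
    nlinarith [norm_nonneg (p.1 - q.1), norm_nonneg (p.2 - q.2)]
  rw [← Set.piecewise_eq_indicator]
  exact hlip.continuousOn.measurable_piecewise continuousOn_const
    (hX.isClosed.prod hY.isClosed).measurableSet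

theorem sub_le_of_convexOn_concaveOn {d T : ℕ} {X Y : Set (E d)} {f : E d → E d → ℝ}
    {gx gy : E d → E d → E d} (hT : 0 < T)
    (hcvx : ∀ y ∈ Y, ConvexOn ℝ X (fun x => f x y))
    (hccv : ∀ x ∈ X, ConcaveOn ℝ Y (fun y => f x y))
    (hgx : ∀ x ∈ X, ∀ y ∈ Y, HasGradientWithinAt (fun x' => f x' y) (gx x y) X x)
    (hgy : ∀ x ∈ X, ∀ y ∈ Y, HasGradientWithinAt (fun y' => f x y') (gy x y) Y y)
    {x y : Fin T → E d} (hx : ∀ t, x t ∈ X) (hy : ∀ t, y t ∈ Y) {u v : E d} (hu : u ∈ X)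
    (hv : v ∈ Y) :
    f ((T : ℝ)⁻¹ • ∑ t, x t) v - f u ((T : ℝ)⁻¹ • ∑ t, y t) ≤
      (T : ℝ)⁻¹ * ∑ t, (inner ℝ (gx (x t) (y t)) (x t - u) +
        inner ℝ (-gy (x t) (y t)) (y t - v)) := by
  have hT' : (T : ℝ) ≠ 0 := by positivity
  have hw : ∑ _ : Fin T, (T : ℝ)⁻¹ = 1 := by simp [hT']
  have h1 := (hcvx v hv).map_sum_le (t := Finset.univ) (w := fun _ : Fin T => (T : ℝ)⁻¹) (p := x)
    (fun _ _ => by positivity) hw fun t _ => hx t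
  have h2 := (hccv u hu).le_map_sum (t := Finset.univ) (w := fun _ : Fin T => (T : ℝ)⁻¹) (p := y)
    (fun _ _ => by positivity) hw fun t _ => hy t
  rw [← Finset.smul_sum, ← Finset.smul_sum, smul_eq_mul] at h1 h2
  have h3 : ∑ t, f (x t) v - ∑ t, f u (y t) ≤ ∑ t, (inner ℝ (gx (x t) (y t)) (x t - u) +
      inner ℝ (-gy (x t) (y t)) (y t - v)) := by
    rw [← Finset.sum_sub_distrib]
    refine Finset.sum_le_sum fun t _ => ?_
    have k1 := inner_sub_le_of_hasGradientWithinAt (hcvx _ (hy t)) (hx t) hu (hgx _ (hx t) _ (hy t))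
    have k2 := inner_sub_le_of_hasGradientWithinAt (hccv _ (hx t)).neg (hy t) hv
      (g := -gy (x t) (y t)) (by
        have := (hgy _ (hx t) _ (hy t)).hasFDerivWithinAt.neg
        rw [hasGradientWithinAt_iff_hasFDerivWithinAt, map_neg]
        exact this)
    have e1 : (inner ℝ (gx (x t) (y t)) (u - x t) : ℝ) = -inner ℝ (gx (x t) (y t)) (x t - u) := by
      rw [← inner_neg_right, neg_sub]
    have e2 : (inner ℝ (-gy (x t) (y t)) (v - y t) : ℝ) =
        -inner ℝ (-gy (x t) (y t)) (y t - v) := by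
      rw [← inner_neg_right, neg_sub]
    simp only [Pi.neg_apply] at k2
    rw [e1] at k1
    rw [e2] at k2
    linarith
  have h4 := mul_le_mul_of_nonneg_left h3 (show 0 ≤ (T : ℝ)⁻¹ by positivity)
  rw [mul_sub] at h4
  exact (sub_le_sub h1 h2).trans h4

theorem IsPerturbedMin.mem {d m : ℕ} {X : Set (E d)} (hX : Convex ℝ X) (hm : 0 < m) {v z : E d}
    {s : Fin m → E d} (h : IsPerturbedMin X v s z) : z ∈ X := by
  obtain ⟨w, hw, rfl⟩ := h
  rw [Finset.smul_sum]
  have : (m : ℝ) ≠ 0 := by positivity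
  exact hX.sum_mem (fun _ _ => by positivity) (by simp [this]) fun j _ => (hw j).1

theorem IsRun.mem {d m T : ℕ} {X Y : Set (E d)} (hX : Convex ℝ X) (hY : Convex ℝ Y) (hm : 0 < m)
    {gx gy : E d → E d → E d} {σ : Player → Stage → Fin T → Fin m → E d} {x y : Fin T → E d}
    (h : IsRun X Y gx gy σ x y) (t : Fin T) : x t ∈ X ∧ y t ∈ Y := by
  rcases Nat.eq_zero_or_pos t.val with h0 | h0
  · obtain ⟨h1, h2⟩ := h.first t h0
    exact ⟨h1.mem hX hm, h2.isPerturbedMin_neg.mem hY hm⟩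
  · obtain ⟨x', y', -, -, h1, h2⟩ := h.later t h0
    exact ⟨h1.mem hX hm, h2.isPerturbedMin_neg.mem hY hm⟩

theorem exists_measurableSet_ae_and {Ω : Type*} [MeasurableSpace Ω] {P : Measure Ω}
    {A : Set Ω} (hA : MeasurableSet A) {p : Ω → Prop} (hp : ∀ᵐ ω ∂P, p ω) :
    ∃ B : Set Ω, MeasurableSet B ∧ P B = P A ∧ ∀ ω ∈ B, ω ∈ A ∧ p ω := by
  refine ⟨A \ toMeasurable P {ω | ¬ p ω}, hA.diff (measurableSet_toMeasurable _ _), ?_,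
    fun ω hω => ⟨hω.1, ?_⟩⟩
  · refine measure_sdiff_null ?_
    rw [measure_toMeasurable]
    exact hp
  · by_contra h
    exact hω.2 (subset_toMeasurable _ _ h)

end OFTPL

/-! ### The main theorem. -/

open OFTPL

theorem mainTheorem11 :
    ∃ c : ℝ, 0 < c ∧
      ∀ (d T : ℕ), 0 < d → 0 < T →
      ∀ (X Y : Set (OFTPL.E d)), IsCompact X → IsCompact Y → X.Nonempty → Y.Nonempty →
      ∀ (f : OFTPL.E d → OFTPL.E d → ℝ) (gx gy : OFTPL.E d → OFTPL.E d → OFTPL.E d) (G L D η : ℝ),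
        D = max (Metric.diam X) (Metric.diam Y) →
        (∀ y ∈ Y, ConvexOn ℝ X (fun x => f x y)) →
        (∀ x ∈ X, ConcaveOn ℝ Y (fun y => f x y)) →
        (∀ x ∈ X, ∀ y ∈ Y, HasGradientWithinAt (fun x' => f x' y) (gx x y) X x) →
        (∀ x ∈ X, ∀ y ∈ Y, HasGradientWithinAt (fun y' => f x y') (gy x y) Y y) →
        (∀ x ∈ X, ∀ y ∈ Y, ‖gx x y‖ ≤ G ∧ ‖gy x y‖ ≤ G) →
        (∀ x ∈ X, ∀ y ∈ Y, ∀ x' ∈ X, ∀ y' ∈ Y,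
          ‖gx x y - gx x' y'‖ + ‖gy x y - gy x' y'‖ ≤ L * ‖x - x'‖ + L * ‖y - y'‖) →
        η = 6 * d * D * (L + 1) →
      ∀ (Ω : Type*) [MeasurableSpace Ω] (P : Measure Ω) [IsProbabilityMeasure P]
        (σ : OFTPL.Player × OFTPL.Stage × Fin T × Fin T → Ω → OFTPL.E d)
        (x y : Fin T → Ω → OFTPL.E d),
        (∀ i, HasLaw (σ i) (OFTPL.uniformBall d ((1 + (d : ℝ)⁻¹) * η)) P) →
        iIndepFun σ P →
        (∀ᵐ ω ∂P, OFTPL.IsRun X Y gx gy (fun p s t j => σ (p, s, t, j) ω)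
          (fun t => x t ω) (fun t => y t ω)) →
      ∀ δ : ℝ, 0 < δ → δ < 1 →
        ∃ A : Set Ω, MeasurableSet A ∧ ENNReal.ofReal (1 - δ) ≤ P A ∧
          ∀ ω ∈ A, ∀ u ∈ X, ∀ v ∈ Y,
            f ((T : ℝ)⁻¹ • ∑ t, x t ω) v - f u ((T : ℝ)⁻¹ • ∑ t, y t ω) ≤
              c * (G * D * Real.sqrt (Real.log (8 / δ)) / T +
                D ^ 2 * (L + 1) * (d + Real.log (16 * T / δ)) / T) := by
  -- 40 = 24 + 16: the perturbation cost 2RD gives 24 and the squared noise 16. The gradient term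
  -- needs only 2 + 5/4.
  refine ⟨40, by norm_num, ?_⟩
  intro d T hd hT X Y hX hY hXne hYne f gx gy G L D η hD hcvx hccv hgx hgy hG hL hη Ω _ P _ σ x y
    hlaw hind hrun δ hδ hδ1
  obtain ⟨x₀, hx₀⟩ := hXne
  obtain ⟨y₀, hy₀⟩ := hYne
  have hcX : Convex ℝ X := (hcvx y₀ hy₀).1
  have hcY : Convex ℝ Y := (hccv x₀ hx₀).1
  have hDX : Metric.diam X ≤ D := hD ▸ le_max_left _ _
  have hDY : Metric.diam Y ≤ D := hD ▸ le_max_right _ _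
  have hd' : (0 : ℝ) < d := by exact_mod_cast hd
  have hT' : (0 : ℝ) < T := by exact_mod_cast hT
  -- If D = 0 the perturbation ball degenerates, but both action sets are single points and the gap
  -- is zero.
  rcases (Metric.diam_nonneg.trans hDX).eq_or_lt with hD0 | hD0
  · obtain ⟨B, hB, hPB, hBp⟩ := exists_measurableSet_ae_and MeasurableSet.univ hrun
    refine ⟨B, hB, ?_, fun ω hω u hu v hv => ?_⟩
    · rw [hPB, measure_univ]
      exact ENNReal.ofReal_le_one.2 (by linarith)
    · have hmem := (hBp ω hω).2.mem hcX hcY hT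
      have hsing {Z : Set (OFTPL.E d)} (hZ : IsCompact Z) (hDZ : Metric.diam Z ≤ D)
          {a b : OFTPL.E d} (ha : a ∈ Z) (hb : b ∈ Z) : a = b :=
        dist_le_zero.1 (((Metric.dist_le_diam_of_mem hZ.isBounded ha hb).trans hDZ).trans hD0.symm.le)
      have e1 : (T : ℝ)⁻¹ • ∑ t, x t ω = u := by
        rw [Finset.sum_congr rfl fun t _ => hsing hX hDX (hmem t).1 hu]
        simp [← Nat.cast_smul_eq_nsmul ℝ, smul_smul, hT'.ne']
      have e2 : (T : ℝ)⁻¹ • ∑ t, y t ω = v := by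
        rw [Finset.sum_congr rfl fun t _ => hsing hY hDY (hmem t).2 hv]
        simp [← Nat.cast_smul_eq_nsmul ℝ, smul_smul, hT'.ne']
      rw [e1, e2, ← hD0]
      simp
  -- A negative L would force both diameters to vanish.
  have hL0 : 0 ≤ L := by
    by_contra! hneg
    have hdiam : Metric.diam X ≤ 0 ∧ Metric.diam Y ≤ 0 := by
      refine ⟨Metric.diam_le_of_forall_dist_le le_rfl fun a ha b hb => ?_,
        Metric.diam_le_of_forall_dist_le le_rfl fun a ha b hb => ?_⟩
      · have := hL a ha y₀ hy₀ b hb y₀ hy₀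
        rw [sub_self, norm_zero, mul_zero, add_zero] at this
        rw [dist_eq_norm]
        nlinarith [norm_nonneg (gx a y₀ - gx b y₀), norm_nonneg (gy a y₀ - gy b y₀)]
      · have := hL x₀ hx₀ a ha x₀ hx₀ b hb
        rw [sub_self, norm_zero, mul_zero, zero_add] at this
        rw [dist_eq_norm]
        nlinarith [norm_nonneg (gx x₀ a - gx x₀ b), norm_nonneg (gy x₀ a - gy x₀ b)]
    exact hD0.not_ge (hD ▸ max_le hdiam.1 hdiam.2)
  have hG0 : 0 ≤ G := (norm_nonneg _).trans (hG x₀ hx₀ y₀ hy₀).1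
  set R := (1 + (d : ℝ)⁻¹) * η with hRdef
  have hη0 : 0 < η := by rw [hη]; positivity
  have hR : 0 < R := by positivity
  have hηR : η ≤ R := by
    rw [hRdef]
    exact le_mul_of_one_le_left hη0.le (le_add_of_nonneg_right (by positivity))
  have hR2 : R ≤ 12 * d * D * (L + 1) := by
    have : (d : ℝ)⁻¹ ≤ 1 := inv_le_one_of_one_le₀ (by exact_mod_cast hd)
    calc R ≤ 2 * η := by rw [hRdef]; gcongr; linarith
      _ = _ := by rw [hη]; ring
  have hRL : 6 * d * D * L ≤ R := by
    refine le_trans ?_ hηR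
    rw [hη]
    gcongr
    linarith
  obtain ⟨sx, hsx⟩ := exists_isArgminSelection hX ⟨x₀, hx₀⟩
  obtain ⟨sy, hsy⟩ := exists_isArgminSelection hY ⟨y₀, hy₀⟩
  set F : OFTPL.E d × OFTPL.E d → OFTPL.E d × OFTPL.E d :=
    (X ×ˢ Y).indicator fun p => (gx p.1 p.2, -gy p.1 p.2) with hFdef
  have hFm : Measurable F := measurable_indicator_of_lipschitz hX hY hL
  have hF (p) (hp : p ∈ X ×ˢ Y) : F p = (gx p.1 p.2, -gy p.1 p.2) := Set.indicator_of_mem hp _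
  have hFG (p) (hp : p ∈ X ×ˢ Y) : ‖(F p).1‖ ≤ G ∧ ‖(F p).2‖ ≤ G := by
    rw [hF p hp, norm_neg]
    exact hG _ hp.1 _ hp.2
  have hFL (p) (hp : p ∈ X ×ˢ Y) (q) (hq : q ∈ X ×ˢ Y) :
      ‖(F p).1 - (F q).1‖ + ‖(F p).2 - (F q).2‖ ≤ L * ‖p.1 - q.1‖ + L * ‖p.2 - q.2‖ := by
    rw [hF p hp, hF q hq, neg_sub_neg, norm_sub_rev (gy q.1 q.2)]
    exact hL _ hp.1 _ hp.2 _ hq.1 _ hq.2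
  -- A law only guarantees almost everywhere measurability, while the past σ-algebras need
  -- measurable perturbations.
  set τ := fun i => (hlaw i).aemeasurable.mk (σ i)
  have hτ (i) : Measurable (τ i) := (hlaw i).aemeasurable.measurable_mk
  have hτσ (i) : σ i =ᵐ[P] τ i := (hlaw i).aemeasurable.ae_eq_mk
  have hτlaw (i) : P.map (τ i) = uniformBall d R := by
    rw [← Measure.map_congr (hτσ i), (hlaw i).map_eq]
  have hτind : iIndepFun τ P := hind.congr hτσ
  have hall : ∀ᵐ ω ∂P, ∀ p s t j, σ (p, s, t, j) ω = τ (p, s, t, j) ω := by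
    have hp (p : Player) (s : Stage) : ∀ᵐ ω ∂P, ∀ t j, σ (p, s, t, j) ω = τ (p, s, t, j) ω :=
      ae_all_iff.2 fun t => ae_all_iff.2 fun j => hτσ _
    filter_upwards [hp .xPlayer .guess, hp .yPlayer .guess, hp .xPlayer .play, hp .yPlayer .play]
      with ω h1 h2 h3 h4
    rintro (_ | _) (_ | _)
    exacts [h1, h3, h2, h4]
  obtain ⟨A, hA, hPA, hAω⟩ := exists_measurableSet_noise_le hτ hτind hτlaw hFm hsx hsy hcX hcY
    hX hY hd hR hT hDX hDY hD0 hFG hδ hδ1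
  obtain ⟨B, hB, hPB, hBω⟩ := exists_measurableSet_ae_and hA
    ((hrun.and hall).and (ae_eq_playPoint hτ hτind hτlaw hR hFm hsx hsy hcX hcY hT hF))
  refine ⟨B, hB, hPA.trans_eq hPB.symm, fun ω hω u hu v hv => ?_⟩
  obtain ⟨hωA, ⟨hωrun, hωσ⟩, hωplay⟩ := hBω ω hω
  obtain ⟨hS1, hS2⟩ := hAω ω hωA
  have hmem := hωrun.mem hcX hcY hT
  simp only [hωσ] at hωrun
  have hplay := hωplay _ _ hωrun
  have hreg := sum_inner_playPoint_sub_le hsx hsy hcX hcY hX hY hd hR hT hL0 hDX hDY hD0 hRL hFL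
    hFG (perturbation τ ω) T hu hv
  rw [← Fin.sum_univ_eq_sum_range fun t =>
    (inner ℝ (F (playPoint F sx sy (perturbation τ ω) t)).1
        ((playPoint F sx sy (perturbation τ ω) t).1 - u) +
      inner ℝ (F (playPoint F sx sy (perturbation τ ω) t)).2
        ((playPoint F sx sy (perturbation τ ω) t).2 - v) : ℝ)] at hreg
  simp only [← hplay, hF _ (Set.mk_mem_prod (hmem _).1 (hmem _).2)] at hreg
  refine (sub_le_of_convexOn_concaveOn hT hcvx hccv hgx hgy (fun t => (hmem t).1)
    (fun t => (hmem t).2) hu hv).trans ?_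
  set w := Real.sqrt (Real.log (8 / δ)) with hw
  -- Since e ≤ 8/δ, the first-round cost 2GD is absorbed in the logarithmic term.
  have hw1 : 1 ≤ w := by
    rw [hw, Real.one_le_sqrt, Real.le_log_iff_exp_le (by positivity), le_div_iff₀ hδ]
    nlinarith [Real.exp_one_lt_d9, Real.exp_pos 1]
  have hlog0 : 0 ≤ Real.log (16 * T / δ) := by
    refine Real.log_nonneg ?_
    rw [le_div_iff₀ hδ]
    have : (1 : ℝ) ≤ T := by exact_mod_cast hT
    linarith
  have b1 : 2 * R * D ≤ 24 * (D ^ 2 * (L + 1) * d) := by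
    have := mul_le_mul_of_nonneg_right hR2 (mul_nonneg zero_le_two hD0.le)
    linarith
  have b2 : 2 * G * D ≤ 2 * (G * D * w) := by
    have := le_mul_of_one_le_right (mul_nonneg hG0 hD0.le) hw1
    linarith
  have b3 : 8 * L * ∑ t ∈ Finset.range T, squaredNoise F sx sy (perturbation τ ω) R t ≤
      16 * (D ^ 2 * (L + 1) * (d + Real.log (16 * T / δ))) := by
    calc _ ≤ 8 * L * (D ^ 2 * (2 * d + Real.log (16 * T / δ))) := by gcongr
      _ ≤ 8 * (L + 1) * (D ^ 2 * (2 * d + 2 * Real.log (16 * T / δ))) := by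
          gcongr <;> linarith
      _ = _ := by ring
  have b4 : 0 ≤ D ^ 2 * (L + 1) * Real.log (16 * T / δ) := by positivity
  have b5 : 0 ≤ G * D * w := by positivity
  rw [← add_div, mul_div_assoc', inv_mul_eq_div]
  gcongr
  refine hreg.trans ?_
  rw [mul_add (D ^ 2 * (L + 1))] at b3 ⊢
  linarith
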